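/- **Theorem (expressions for $\chi_n$, $\lambda_n$ and $\delta_n$).** For an integer $n\ge 1$ put $$\chi_n=\int_0^\infty\frac{\operatorname{sech}x-\operatorname{sech}^nx}{x^2}\,dx,\qquad \lambda_n=\int_0^\infty\frac{\tanh x\,\operatorname{sech}^nx}{x}\,dx,\qquad \delta_n=\int_0^\infty\frac{1-\operatorname{sech}x}{x^2}\operatorname{sech}^nx\,dx .$$ Let $G=\sum_{k\ge0}(-1)^k/(2k+1)^2$ be Catalan's constant. For $0\le k\le m$ let $P_k(m,x)$ be the polynomials determined by the identity in $j$ $$(j+1)(j+2)\cdots(j+m)=\sum_{k=0}^m(-1)^kP_k(m,x)\,(j+x)^{m-k}.$$ For $x>0$ let $\zeta(s,x)$ be the Hurwitz zeta function, that is, the analytic continuation to $s\in\mathbb C\setminus\{1\}$ of $\sum_{k\ge0}(k+x)^{-s}$ ($\Re s>1$). Put $D(s;x,y)=\zeta'(s,x)-\zeta'(s,y)$, where $'$ is the derivative in $s$; for $s=1$, $D(1;x,y)$ stands for $\lim_{w\to1}\left(\zeta'(w,x)-\zeta'(w,y)\right)$. Then all the integrals above converge absolutely, and the following identities hold. For every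 $n\ge1$, $$\chi_{2n}=-\frac{4G}{\pi}+\frac{2^{4n+1}}{(2n-1)!}\sum_{k=1}^{n}\frac1{4^k}\left(n^2P_{2k-2}(2n-1,n)+P_{2k}(2n+1,n+1)\right)D\!\left(-2n+2k;\tfrac n2,\tfrac{n+1}2\right)$$ $$\qquad+\frac{2^{4n+1}n^{2n}\ln\frac n2}{4^n(2n-1)!}\sum_{k=1}^n\frac1{n^{2k}}P_{2k}(2n+1,n+1)-\frac{2^{4n+1}}{(2n-1)!}D\!\left(-2n;\tfrac{n+1}2,\tfrac{n+2}2\right).$$ For every $n\ge0$, $$\chi_{2n+1}=-\frac{4G}{\pi}+\frac{2^{4n-1}(2n+1)^2}{(2n)!}\sum_{k=0}^n\frac1{4^k}P_{2k}\!\left(2n,\tfrac{2n+1}2\right)D\!\left(-2n+2k+1;\tfrac{2n+1}4,\tfrac{2n+3}4\right)$$ $$\qquad-\frac{2^{4n+3}}{(2n)!}\sum_{k=0}^{n+1}\frac1{4^k}P_{2k}\!\left(2n+2,\tfrac{2n+3}2\right)D\!\left(-2n+2k-1;\tfrac{2n+3}4,\tfrac{2n+5}4\right).$$ For every $n\ge1$,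 $$\lambda_{2n}=\frac{2^{4n}}{n(2n-1)!}\sum_{k=1}^{n}\frac1{4^k}\left(n^2P_{2k-2}(2n-1,n)+P_{2k}(2n+1,n+1)\right)D\!\left(-2n+2k;\tfrac n2,\tfrac{n+1}2\right)$$ $$\qquad+\frac{2^{2n}n^{2n-1}\ln\frac n2}{(2n-1)!}\sum_{k=1}^n\frac1{n^{2k}}P_{2k}(2n+1,n+1)-\frac{2^{4n}}{n(2n-1)!}D\!\left(-2n;\tfrac{n+1}2,\tfrac{n+2}2\right).$$ For every $n\ge0$, $$\lambda_{2n+1}=\frac{2^{4n-1}(2n+1)}{(2n)!}\sum_{k=0}^n\frac1{4^k}P_{2k}\!\left(2n,\tfrac{2n+1}2\right)D\!\left(-2n+2k+1;\tfrac{2n+1}4,\tfrac{2n+3}4\right)$$ $$\qquad-\frac{2^{4n+3}}{(2n+1)!}\sum_{k=0}^{n+1}\frac1{4^k}P_{2k}\!\left(2n+2,\tfrac{2n+3}2\right)D\!\left(-2n+2k-1;\tfrac{2n+3}4,\tfrac{2n+5}4\right).$$ For every $n\ge1$, $$\delta_n=\frac{2^{2n-1}(n+1)^2}{n!}\sum_{k=0}^n\left(-\tfrac12\right)^kP_k\!\left(n,\tfrac{n+1}2\right)D\!\left(k-n+1;\tfrac{n+1}4,\tfrac{n+3}4\right)$$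 $$\qquad-\frac{2^{2n+3}}{n!}\sum_{k=0}^{n+2}\left(-\tfrac12\right)^kP_k\!\left(n+2,\tfrac{n+3}2\right)D\!\left(k-n-1;\tfrac{n+3}4,\tfrac{n+5}4\right)$$ $$\qquad-\frac{2^{2n-3}n^2}{(n-1)!}\sum_{k=0}^{n-1}\left(-\tfrac12\right)^kP_k\!\left(n-1,\tfrac n2\right)D\!\left(k-n+2;\tfrac n4,\tfrac{n+2}4\right)$$ $$\qquad+\frac{2^{2n+1}}{(n-1)!}\sum_{k=0}^{n+1}\left(-\tfrac12\right)^kP_k\!\left(n+1,\tfrac{n+2}2\right)D\!\left(k-n;\tfrac{n+2}4,\tfrac{n+4}4\right).$$ -/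

import Mathlib

namespace SechIntegrals

noncomputable section

open MeasureTheory Filter Topology

/-- The hyperbolic secant. -/
def sech (x : ℝ) : ℝ := (Real.cosh x)⁻¹

/-- Integrand of `lam n`. -/
def lamIntegrand (n : ℕ) (x : ℝ) : ℝ := Real.tanh x * sech x ^ n / x

/-- Integrand of `del n`. -/
def delIntegrand (n : ℕ) (x : ℝ) : ℝ := (1 - sech x) / x ^ 2 * sech x ^ n

/-- Integrand of `chi n`. -/
def chiIntegrand (n : ℕ) (x : ℝ) : ℝ := (sech x - sech x ^ n) / x ^ 2

/-- `λ_n = ∫_0^∞ tanh x sech^n x / x dx`. -/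
def lam (n : ℕ) : ℝ := ∫ x in Set.Ioi (0 : ℝ), lamIntegrand n x

/-- `δ_n = ∫_0^∞ (1 - sech x) sech^n x / x^2 dx`. -/
def del (n : ℕ) : ℝ := ∫ x in Set.Ioi (0 : ℝ), delIntegrand n x

/-- `χ_n = ∫_0^∞ (sech x - sech^n x) / x^2 dx`. -/
def chi (n : ℕ) : ℝ := ∫ x in Set.Ioi (0 : ℝ), chiIntegrand n x

/-- Catalan's constant `G = ∑_{k ≥ 0} (-1)^k / (2 k + 1)^2`. -/
def catalanG : ℝ := ∑' k : ℕ, (-1 : ℝ) ^ k / (2 * (k : ℝ) + 1) ^ 2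

theorem summable_catalanG : Summable fun k : ℕ => (-1 : ℝ) ^ k / (2 * (k : ℝ) + 1) ^ 2 := by
  have h : Summable fun k : ℕ => 1 / ((k : ℝ) + 1) ^ 2 := by
    have := (summable_nat_add_iff 1).2 (Real.summable_one_div_nat_pow.2 (one_lt_two))
    simpa using this
  refine Summable.of_norm_bounded h fun k => ?_
  have hk : (0 : ℝ) ≤ k := k.cast_nonneg
  rw [norm_div, norm_pow, norm_neg, norm_one, one_pow, Real.norm_of_nonneg (by positivity)]
  gcongr
  linarith

/-- The signed generalized Stirling polynomials `P_k(m, x)`, `0 ≤ k ≤ m`: up to the sign `(-1)^k`,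
the coefficient of `y^(m-k)` in the rising factorial `(y - x + 1)_m`. Equivalently,
`(j + 1)_m = ∑_{k=0}^m (-1)^k P_k(m, x) (j + x)^(m-k)` identically in `j`; see `sum_stirlingP`. -/
def stirlingP (k m : ℕ) (x : ℂ) : ℂ :=
  (-1) ^ k * ((ascPochhammer ℂ m).comp (Polynomial.X + Polynomial.C (1 - x))).coeff (m - k)

theorem sum_stirlingP (m : ℕ) (x j : ℂ) :
    (ascPochhammer ℂ m).eval (j + 1) =
      ∑ k ∈ Finset.range (m + 1), (-1) ^ k * stirlingP k m x * (j + x) ^ (m - k) := by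
  have h1 : (ascPochhammer ℂ m).eval (j + 1) =
      ((ascPochhammer ℂ m).comp (Polynomial.X + Polynomial.C (1 - x))).eval (j + x) := by
    simp [Polynomial.eval_comp]
  have hd : ((ascPochhammer ℂ m).comp (Polynomial.X + Polynomial.C (1 - x))).natDegree < m + 1 := by
    rw [Polynomial.natDegree_comp, ascPochhammer_natDegree, Polynomial.natDegree_X_add_C]
    omega
  rw [h1, Polynomial.eval_eq_sum_range' hd, ← Finset.sum_range_reflect]
  refine Finset.sum_congr rfl fun k hk => ?_
  have e : m + 1 - 1 - k = m - k := by omega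
  have s : ((-1 : ℂ) ^ k) * (-1) ^ k = 1 := by rw [← mul_pow]; simp
  rw [e, stirlingP, ← mul_assoc ((-1 : ℂ) ^ k), s, one_mul]

/-- The Hurwitz zeta function `ζ(s, x)` for real `x > 0`: the analytic continuation in `s` of
`∑_{n ≥ 0} (n + x)^(-s)`. Mathlib's `HurwitzZeta.hurwitzZeta` depends only on `x` modulo `1` and
gives this sum for `0 < x ≤ 1`; for larger `x` the first `⌈x⌉ - 1` terms have to be removed. -/
def zetaH (s : ℂ) (x : ℝ) : ℂ :=
  HurwitzZeta.hurwitzZeta (x : UnitAddCircle) s -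
    ∑ j ∈ Finset.range (⌈x⌉₊ - 1), 1 / ((j : ℂ) + ((x - (⌈x⌉₊ - 1 : ℕ) : ℝ) : ℂ)) ^ s

theorem fract_part_mem {x : ℝ} (hx : 0 < x) :
    0 < x - (⌈x⌉₊ - 1 : ℕ) ∧ x - (⌈x⌉₊ - 1 : ℕ) ≤ 1 := by
  have h1 : 1 ≤ ⌈x⌉₊ := Nat.one_le_ceil_iff.2 hx
  have h2 := Nat.ceil_lt_add_one hx.le
  have h3 := Nat.le_ceil x
  rw [Nat.cast_sub h1]
  push_cast
  constructor <;> linarith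

theorem hasSum_zetaH {x : ℝ} (hx : 0 < x) {s : ℂ} (hs : 1 < s.re) :
    HasSum (fun n : ℕ => 1 / ((n : ℂ) + (x : ℂ)) ^ s) (zetaH s x) := by
  obtain ⟨h0, h1⟩ := fract_part_mem hx
  have hc : ((x - (⌈x⌉₊ - 1 : ℕ) : ℝ) : UnitAddCircle) = (x : UnitAddCircle) := by
    rw [AddCircle.coe_sub, sub_eq_self, AddCircle.coe_eq_zero_iff]
    exact ⟨((⌈x⌉₊ - 1 : ℕ) : ℤ), by simp⟩
  have h := HurwitzZeta.hasSum_hurwitzZeta_of_one_lt_re (a := x - (⌈x⌉₊ - 1 : ℕ))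
    ⟨h0.le, h1⟩ hs
  rw [hc, ← hasSum_nat_add_iff' (⌈x⌉₊ - 1)] at h
  convert! h using 2 with n
  push_cast
  ring_nf

theorem differentiableAt_zetaH {x : ℝ} (hx : 0 < x) {s : ℂ} (hs : s ≠ 1) :
    DifferentiableAt ℂ (fun w => zetaH w x) s := by
  obtain ⟨h0, -⟩ := fract_part_mem hx
  refine (HurwitzZeta.differentiableAt_hurwitzZeta _ hs).sub
    (DifferentiableAt.fun_sum fun j _ => ?_)
  have hne : (j : ℂ) + ((x - (⌈x⌉₊ - 1 : ℕ) : ℝ) : ℂ) ≠ 0 := by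
    rw [← Complex.ofReal_natCast, ← Complex.ofReal_add, Complex.ofReal_ne_zero]
    positivity
  refine DifferentiableAt.div (by fun_prop) (differentiableAt_id.const_cpow (Or.inl hne)) ?_
  rw [Ne, Complex.cpow_eq_zero_iff]
  exact fun h => hne h.1

/-- The difference `ζ'(s, x) - ζ'(s, y)` of derivatives with respect to `s`, where at the pole
`s = 1` it stands, by convention, for the limit of `ζ'(w, x) - ζ'(w, y)` as `w → 1`. -/
def zetaDerivDiff (s : ℂ) (x y : ℝ) : ℂ :=
  if s = 1 then
    limUnder (𝓝[≠] (1 : ℂ)) fun w => deriv (fun u => zetaH u x) w - deriv (fun u => zetaH u y) w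
  else deriv (fun u => zetaH u x) s - deriv (fun u => zetaH u y) s

theorem tendsto_zetaDerivDiff_one {x y : ℝ} (hx : 0 < x) (hy : 0 < y) :
    Tendsto (fun w => deriv (fun u => zetaH u x) w - deriv (fun u => zetaH u y) w)
      (𝓝[≠] (1 : ℂ)) (𝓝 (zetaDerivDiff 1 x y)) := by
  have hd : Differentiable ℂ fun u => zetaH u x - zetaH u y := by
    have hf : ∀ z : ℝ, 0 < z → Differentiable ℂ fun s : ℂ =>
        ∑ j ∈ Finset.range (⌈z⌉₊ - 1), 1 / ((j : ℂ) + ((z - (⌈z⌉₊ - 1 : ℕ) : ℝ) : ℂ)) ^ s := by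
      intro z hz
      obtain ⟨h0, -⟩ := fract_part_mem hz
      refine Differentiable.fun_sum fun j _ => ?_
      have hne : (j : ℂ) + ((z - (⌈z⌉₊ - 1 : ℕ) : ℝ) : ℂ) ≠ 0 := by
        rw [← Complex.ofReal_natCast, ← Complex.ofReal_add, Complex.ofReal_ne_zero]
        positivity
      refine Differentiable.div (by fun_prop) (differentiable_id.const_cpow (Or.inl hne)) ?_
      intro s
      rw [Ne, Complex.cpow_eq_zero_iff]
      exact fun h => hne h.1
    have h := ((HurwitzZeta.differentiable_hurwitzZeta_sub_hurwitzZeta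
      (x : UnitAddCircle) (y : UnitAddCircle)).sub (hf x hx)).add (hf y hy)
    convert! h using 1
    funext u
    simp only [zetaH, Pi.add_apply, Pi.sub_apply]
    ring
  have hc : Continuous (deriv fun u => zetaH u x - zetaH u y) :=
    (hd.contDiff (n := 1)).continuous_deriv le_rfl
  have ht : Tendsto (fun w => deriv (fun u => zetaH u x) w - deriv (fun u => zetaH u y) w)
      (𝓝[≠] (1 : ℂ)) (𝓝 (deriv (fun u => zetaH u x - zetaH u y) 1)) := by
    refine (hc.continuousAt.tendsto.mono_left nhdsWithin_le_nhds).congr' ?_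
    filter_upwards [self_mem_nhdsWithin] with w hw
    exact deriv_fun_sub (differentiableAt_zetaH hx hw) (differentiableAt_zetaH hy hw)
  rw [zetaDerivDiff, if_pos rfl, ht.limUnder_eq]
  exact ht

end

end SechIntegrals

/-!
Put `n = m + 1`. Termwise integration of
`sech^n x = 2^n ∑ (-1)^j C(j + m, m) exp (-(2 j + n) x)` gives, for `Re s > n`, the Mellin transform
of `sech^n` as `Γ(s)` times an alternating Dirichlet series. Since `m! C(j + m, m) = (j + 1)_m`, the
polynomials `P_k(m, n / 2)` expand its coefficients in powers of `j + n / 2`, and splitting `j` by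
parity turns the series into the entire function `sechZeta m`, a finite combination of differences
of Hurwitz zeta functions. By the identity theorem the formula persists for `Re s > 0`
(`mellin_sechPow`).

Integration by parts against `log` writes `λ_n` as the derivative at `s = 1` of the Mellin transform
of `n sech^n - (n + 1) sech^(n+2) = -(tanh sech^n)'`. That transform vanishes at `s = 1`, so only the
derivatives of the zeta functions survive, and `n λ_n` is an explicit combination of the values
`D(s; x, y)` (`mul_lam_succ`). As `P_k(m, (m + 1) / 2) = 0` for odd `k`
(`stirlingP_eq_zero_of_odd`), this is the formula at odd indices; at even indices the shift
`ζ(s, x + 1) = ζ(s, x) - x^(-s)` rearranges it and produces the logarithms.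

Finally `χ_n = n λ_n - λ_1` and `δ_n = χ_{n+1} - χ_n`. The constant `λ_1 = 4 G / π` follows from the
formula for `λ_1`, in which all terms but `8 D(-1; 1/4, 3/4)` cancel, and from the functional equation
of the odd Hurwitz zeta function, which gives `D(-1; 1/4, 3/4) = G / (2 π)`.
-/

namespace SechIntegrals

open MeasureTheory Filter Topology

/-! ### Elementary bounds for the hyperbolic secant -/

lemma sech_pos (x : ℝ) : 0 < sech x := inv_pos.2 (Real.cosh_pos x)

lemma sech_le_one (x : ℝ) : sech x ≤ 1 := inv_le_one_of_one_le₀ (Real.one_le_cosh x)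

lemma sech_le_two_mul_exp_neg (x : ℝ) : sech x ≤ 2 * Real.exp (-x) := by
  rw [sech, inv_le_iff_one_le_mul₀ (Real.cosh_pos x), Real.cosh_eq]
  have h1 : Real.exp (-x) * Real.exp x = 1 := by rw [← Real.exp_add]; simp
  nlinarith [sq_nonneg (Real.exp (-x))]

lemma sech_pow_le {n : ℕ} (hn : 1 ≤ n) (x : ℝ) : sech x ^ n ≤ 2 * Real.exp (-x) :=
  (pow_le_of_le_one (sech_pos x).le (sech_le_one x) (by omega)).trans (sech_le_two_mul_exp_neg x)

lemma continuous_sech : Continuous sech :=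
  Real.continuous_cosh.inv₀ fun x => (Real.cosh_pos x).ne'

lemma one_sub_sech_le (x : ℝ) : 1 - sech x ≤ x ^ 2 / 2 := by
  have h1 : Real.exp (-(x ^ 2 / 2)) ≤ sech x := by
    rw [Real.exp_neg, sech]
    exact inv_anti₀ (Real.cosh_pos x) (Real.cosh_le_exp_half_sq x)
  linarith [Real.add_one_le_exp (-(x ^ 2 / 2))]

lemma one_sub_sech_pow_le (n : ℕ) (x : ℝ) : 1 - sech x ^ n ≤ n * (x ^ 2 / 2) := by
  have h := one_add_mul_le_pow (a := sech x - 1) (by linarith [sech_pos x]) n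
  rw [add_sub_cancel] at h
  nlinarith [one_sub_sech_le x, (n.cast_nonneg : (0 : ℝ) ≤ n)]

lemma one_sub_sech_pow_nonneg (n : ℕ) (x : ℝ) : 0 ≤ 1 - sech x ^ n :=
  sub_nonneg.2 (pow_le_one₀ (sech_pos x).le (sech_le_one x))

lemma tanh_eq_sinh_mul_sech (x : ℝ) : Real.tanh x = Real.sinh x * sech x := by
  rw [Real.tanh_eq_sinh_div_cosh, sech, div_eq_mul_inv]

lemma tanh_nonneg {x : ℝ} (hx : 0 ≤ x) : 0 ≤ Real.tanh x := by
  rw [tanh_eq_sinh_mul_sech]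
  exact mul_nonneg (Real.sinh_nonneg_iff.2 hx) (sech_pos x).le

lemma tanh_sq (x : ℝ) : Real.tanh x ^ 2 = 1 - sech x ^ 2 := by
  have h := Real.cosh_sq x
  have h0 := (Real.cosh_pos x).ne'
  rw [Real.tanh_eq_sinh_div_cosh, sech]
  field_simp
  linarith

lemma hasDerivAt_sech (x : ℝ) : HasDerivAt sech (-(sech x * Real.tanh x)) x := by
  refine ((Real.hasDerivAt_cosh x).fun_inv (Real.cosh_pos x).ne').congr_deriv ?_
  rw [Real.tanh_eq_sinh_div_cosh, sech]
  field_simp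

lemma hasDerivAt_tanh (x : ℝ) : HasDerivAt Real.tanh (sech x ^ 2) x := by
  have h := (Real.hasDerivAt_sinh x).mul (hasDerivAt_sech x)
  refine (h.congr_deriv ?_).congr_of_eventuallyEq
    (Eventually.of_forall tanh_eq_sinh_mul_sech)
  have h1 : Real.cosh x * sech x = 1 := mul_inv_cancel₀ (Real.cosh_pos x).ne'
  have h2 := tanh_sq x
  have h3 := tanh_eq_sinh_mul_sech x
  linear_combination h1 - h2 + Real.tanh x * h3

lemma continuous_tanh : Continuous Real.tanh :=
  continuous_iff_continuousAt.2 fun x => (hasDerivAt_tanh x).continuousAt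

lemma tanh_le_self {x : ℝ} (hx : 0 ≤ x) : Real.tanh x ≤ x := by
  have hd : ∀ y, HasDerivAt (fun y => y - Real.tanh y) (1 - sech y ^ 2) y :=
    fun y => (hasDerivAt_id y).sub (hasDerivAt_tanh y)
  have hm : Monotone fun y => y - Real.tanh y :=
    monotone_of_deriv_nonneg (fun y => (hd y).differentiableAt) fun y => by
      rw [(hd y).deriv]; exact one_sub_sech_pow_nonneg 2 y
  have := hm hx
  simp only [Real.tanh_zero] at this
  linarith

lemma hasDerivAt_sech_pow (n : ℕ) (x : ℝ) :
    HasDerivAt (fun y => sech y ^ n) (-(n * (Real.tanh x * sech x ^ n))) x := by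
  refine ((hasDerivAt_sech x).pow n).congr_deriv ?_
  rcases n with _ | n
  · simp
  · simp only [Nat.add_sub_cancel]; ring

lemma hasDerivAt_tanh_mul_sech_pow (n : ℕ) (x : ℝ) :
    HasDerivAt (fun y => Real.tanh y * sech y ^ n)
      ((n + 1) * sech x ^ (n + 2) - n * sech x ^ n) x := by
  refine ((hasDerivAt_tanh x).mul (hasDerivAt_sech_pow n x)).congr_deriv ?_
  linear_combination (-(n : ℝ) * sech x ^ n) * tanh_sq x

/-! ### Convergence of the integrals -/

lemma integrableOn_of_le_mul_exp_neg {f : ℝ → ℝ} (hf : ContinuousOn f (Set.Ioi 0)) (C : ℝ)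
    (h : ∀ x, 0 < x → |f x| ≤ C * Real.exp (-x)) : IntegrableOn f (Set.Ioi 0) := by
  refine Integrable.mono' ((integrableOn_exp_neg_Ioi 0).const_mul C)
    (hf.aestronglyMeasurable measurableSet_Ioi) ?_
  filter_upwards [ae_restrict_mem measurableSet_Ioi] with x hx
  exact h x hx

lemma integrableOn_lamIntegrand {n : ℕ} (hn : 1 ≤ n) :
    IntegrableOn (lamIntegrand n) (Set.Ioi 0) := by
  refine integrableOn_of_le_mul_exp_neg (fun x hx => ?_) 2 fun x hx => ?_
  · exact (((continuous_tanh.mul (continuous_sech.pow n)).continuousAt).div continuousAt_id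
      (ne_of_gt hx)).continuousWithinAt
  · have h1 := tanh_nonneg hx.le
    have h2 : 0 ≤ sech x ^ n := pow_nonneg (sech_pos x).le n
    rw [lamIntegrand, abs_of_nonneg (by positivity), div_le_iff₀ hx]
    calc Real.tanh x * sech x ^ n ≤ x * (2 * Real.exp (-x)) :=
          mul_le_mul (tanh_le_self hx.le) (sech_pow_le hn x) h2 hx.le
      _ = _ := by ring

lemma integrableOn_delIntegrand {n : ℕ} (hn : 1 ≤ n) :
    IntegrableOn (delIntegrand n) (Set.Ioi 0) := by
  refine integrableOn_of_le_mul_exp_neg (fun x hx => ?_) 1 fun x hx => ?_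
  · exact ((((continuous_const.sub continuous_sech).continuousAt).div
      (continuous_pow 2).continuousAt (pow_pos hx 2).ne').mul
      (continuous_sech.pow n).continuousAt).continuousWithinAt
  · have h1 : 0 ≤ 1 - sech x := by linarith [sech_le_one x]
    have h2 : 0 ≤ sech x ^ n := pow_nonneg (sech_pos x).le n
    have h3 : (1 - sech x) / x ^ 2 ≤ 1 / 2 := by
      rw [div_le_iff₀ (by positivity)]; linarith [one_sub_sech_le x]
    rw [delIntegrand, abs_of_nonneg (by positivity)]
    calc (1 - sech x) / x ^ 2 * sech x ^ n ≤ 1 / 2 * (2 * Real.exp (-x)) :=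
          mul_le_mul h3 (sech_pow_le hn x) h2 (by norm_num)
      _ = _ := by ring

lemma chiIntegrand_succ (n : ℕ) (x : ℝ) :
    chiIntegrand (n + 1) x = sech x * ((1 - sech x ^ n) / x ^ 2) := by
  rw [chiIntegrand]; ring

lemma integrableOn_chiIntegrand {n : ℕ} (hn : 1 ≤ n) :
    IntegrableOn (chiIntegrand n) (Set.Ioi 0) := by
  obtain ⟨n, rfl⟩ := Nat.exists_eq_add_of_le' hn
  refine integrableOn_of_le_mul_exp_neg (fun x hx => ?_) n fun x hx => ?_
  · exact (((continuous_sech.sub (continuous_sech.pow _)).continuousAt).div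
      (continuous_pow 2).continuousAt (pow_pos hx 2).ne').continuousWithinAt
  · have h1 := one_sub_sech_pow_nonneg n x
    have h2 := (sech_pos x).le
    have h3 : (1 - sech x ^ n) / x ^ 2 ≤ n / 2 := by
      rw [div_le_iff₀ (by positivity)]; linarith [one_sub_sech_pow_le n x]
    rw [chiIntegrand_succ, abs_of_nonneg (by positivity)]
    calc sech x * ((1 - sech x ^ n) / x ^ 2) ≤ 2 * Real.exp (-x) * (n / 2) :=
          mul_le_mul (sech_le_two_mul_exp_neg x) h3 (by positivity) (by positivity)
      _ = _ := by ring

/-! ### Relations between the integrals -/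

lemma del_eq {n : ℕ} (hn : 1 ≤ n) : del n = chi (n + 1) - chi n := by
  rw [del, chi, chi, ← integral_sub (integrableOn_chiIntegrand (by omega))
    (integrableOn_chiIntegrand hn)]
  refine setIntegral_congr_fun measurableSet_Ioi fun x _ => ?_
  simp only [delIntegrand, chiIntegrand]
  ring

/-- Integration of the derivative of `(sech x - sech x ^ n) / x`, which vanishes at both ends. -/
lemma chi_eq {n : ℕ} (hn : 1 ≤ n) : chi n = n * lam n - lam 1 := by
  obtain ⟨m, rfl⟩ := Nat.exists_eq_add_of_le' hn
  set n := m + 1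
  -- At `0` the junk value of `f` is its limit `0`.
  let f : ℝ → ℝ := fun x => (sech x - sech x ^ n) / x
  have hbound : ∀ x, 0 < x → ‖f x‖ ≤ m * x * Real.exp (-x) := fun x hx => by
    have h1 := one_sub_sech_pow_nonneg m x
    have h2 := (sech_pos x).le
    have e : f x = sech x * ((1 - sech x ^ m) / x) := by simp only [f, n]; ring
    have h3 : (1 - sech x ^ m) / x ≤ m * x / 2 := by
      rw [div_le_iff₀ hx]; linarith [one_sub_sech_pow_le m x]
    rw [e, Real.norm_of_nonneg (by positivity)]
    calc sech x * ((1 - sech x ^ m) / x) ≤ 2 * Real.exp (-x) * (m * x / 2) :=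
          mul_le_mul (sech_le_two_mul_exp_neg x) h3 (by positivity) (by positivity)
      _ = _ := by ring
  have hderiv : ∀ x ∈ Set.Ioi (0 : ℝ), HasDerivAt f
      (n * lamIntegrand n x - lamIntegrand 1 x - chiIntegrand n x) x := fun x hx => by
    have hx0 : x ≠ 0 := ne_of_gt hx
    refine (((hasDerivAt_sech x).sub (hasDerivAt_sech_pow n x)).div (hasDerivAt_id x)
      hx0).congr_deriv ?_
    simp only [lamIntegrand, chiIntegrand, id, Pi.sub_apply]
    field_simp
    ring
  have hlam := (integrableOn_lamIntegrand hn).const_mul (n : ℝ)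
  have hlam1 := integrableOn_lamIntegrand le_rfl
  have hchi := integrableOn_chiIntegrand hn
  have hzero : ContinuousWithinAt f (Set.Ici 0) 0 := by
    rw [← continuousWithinAt_Ioi_iff_Ici, ContinuousWithinAt]
    have h0 : f 0 = 0 := by simp [f]
    rw [h0]
    refine squeeze_zero_norm' (eventually_nhdsWithin_of_forall hbound) ?_
    have : Continuous fun x : ℝ => m * x * Real.exp (-x) := by fun_prop
    simpa using (this.tendsto 0).mono_left nhdsWithin_le_nhds
  have htop : Tendsto f atTop (𝓝 0) := by
    refine squeeze_zero_norm' ((eventually_gt_atTop 0).mono hbound) ?_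
    simpa [mul_assoc] using
      (Real.tendsto_pow_mul_exp_neg_atTop_nhds_zero 1).const_mul (m : ℝ)
  have h := integral_Ioi_of_hasDerivAt_of_tendsto hzero hderiv ((hlam.sub hlam1).sub hchi) htop
  rw [integral_sub (f := fun x => n * lamIntegrand n x - lamIntegrand 1 x) (hlam.sub hlam1) hchi,
    integral_sub hlam hlam1, integral_const_mul] at h
  have h0 : f 0 = 0 := by simp [f]
  rw [h0, ← lam, ← lam, ← chi] at h
  linarith

/-! ### The Mellin transform of powers of the hyperbolic secant -/

/-- The `n`-th power of the hyperbolic secant as a complex-valued function, for use with `mellin`. -/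
noncomputable def sechPow (n : ℕ) (x : ℝ) : ℂ := ((sech x ^ n : ℝ) : ℂ)

lemma continuous_sechPow (n : ℕ) : Continuous (sechPow n) :=
  Complex.continuous_ofReal.comp (continuous_sech.pow n)

lemma norm_sechPow (n : ℕ) (x : ℝ) : ‖sechPow n x‖ = sech x ^ n := by
  rw [sechPow, Complex.norm_real, Real.norm_of_nonneg (pow_nonneg (sech_pos x).le n)]

lemma isBigO_sechPow_atTop {n : ℕ} (hn : 1 ≤ n) :
    sechPow n =O[atTop] fun x : ℝ => Real.exp (-1 * x) := by
  refine Asymptotics.IsBigO.of_bound 2 (Eventually.of_forall fun x => ?_)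
  rw [norm_sechPow, Real.norm_of_nonneg (Real.exp_pos _).le, neg_one_mul]
  exact sech_pow_le hn x

lemma isBigO_sechPow_zero (n : ℕ) : sechPow n =O[𝓝[>] 0] fun x : ℝ => x ^ (-0 : ℝ) := by
  refine Asymptotics.IsBigO.of_bound 1 (Eventually.of_forall fun x => ?_)
  rw [norm_sechPow, neg_zero, Real.rpow_zero, norm_one, one_mul]
  exact pow_le_one₀ (sech_pos x).le (sech_le_one x)

lemma mellin_sechPow_hasDerivAt {n : ℕ} (hn : 1 ≤ n) {s : ℂ} (hs : 0 < s.re) :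
    MellinConvergent (fun t => Real.log t • sechPow n t) s ∧
      HasDerivAt (mellin (sechPow n)) (mellin (fun t => Real.log t • sechPow n t) s) s :=
  mellin_hasDerivAt_of_isBigO_rpow
    ((continuous_sechPow n).locallyIntegrable.locallyIntegrableOn _)
    ((isBigO_sechPow_atTop hn).trans (isLittleO_exp_neg_mul_rpow_atTop one_pos _).isBigO)
    (lt_add_one _) (isBigO_sechPow_zero n) hs

lemma mellin_log_sechPow_one (n : ℕ) :
    mellin (fun t => Real.log t • sechPow n t) 1 =
      ((∫ x in Set.Ioi (0 : ℝ), Real.log x * sech x ^ n : ℝ) : ℂ) := by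
  rw [mellin, ← integral_complex_ofReal]
  refine setIntegral_congr_fun measurableSet_Ioi fun x _ => ?_
  simp [sechPow]

lemma mellin_sechPow_one (n : ℕ) :
    mellin (sechPow n) 1 = ((∫ x in Set.Ioi (0 : ℝ), sech x ^ n : ℝ) : ℂ) := by
  rw [mellin, ← integral_complex_ofReal]
  refine setIntegral_congr_fun measurableSet_Ioi fun x _ => ?_
  simp [sechPow]

lemma integrableOn_sech_pow {n : ℕ} (hn : 1 ≤ n) :
    IntegrableOn (fun x => sech x ^ n) (Set.Ioi 0) :=
  integrableOn_of_le_mul_exp_neg (continuous_sech.pow n).continuousOn 2 fun x _ => by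
    rw [abs_of_nonneg (pow_nonneg (sech_pos x).le n)]
    exact sech_pow_le hn x

lemma integrableOn_log_mul_sech_pow {n : ℕ} (hn : 1 ≤ n) :
    IntegrableOn (fun x => Real.log x * sech x ^ n) (Set.Ioi 0) := by
  have h := (mellin_sechPow_hasDerivAt hn (s := 1) (by simp)).1
  have h2 : IntegrableOn (fun x => ((Real.log x * sech x ^ n : ℝ) : ℂ)) (Set.Ioi 0) := by
    refine IntegrableOn.congr_fun h (fun x _ => ?_) measurableSet_Ioi
    simp [sechPow]
  simpa only [RCLike.re_to_complex, Complex.ofReal_re] using! h2.re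

/-- The derivative of `tanh x * sech x ^ n` has integral zero. -/
lemma mul_integral_sech_pow {n : ℕ} (hn : 1 ≤ n) :
    n * (∫ x in Set.Ioi (0 : ℝ), sech x ^ n) =
      (n + 1) * ∫ x in Set.Ioi (0 : ℝ), sech x ^ (n + 2) := by
  have h1 := (integrableOn_sech_pow hn).const_mul (n : ℝ)
  have h2 := (integrableOn_sech_pow (n := n + 2) (by omega)).const_mul ((n : ℝ) + 1)
  have hc : Continuous fun y => Real.tanh y * sech y ^ n :=
    continuous_tanh.mul (continuous_sech.pow n)
  have htop : Tendsto (fun y => Real.tanh y * sech y ^ n) atTop (𝓝 0) := by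
    refine squeeze_zero_norm' (a := fun x : ℝ => x * (2 * Real.exp (-x)))
      ((eventually_gt_atTop 0).mono fun x hx => ?_) ?_
    · rw [Real.norm_of_nonneg (mul_nonneg (tanh_nonneg hx.le) (pow_nonneg (sech_pos x).le n))]
      exact mul_le_mul (tanh_le_self hx.le) (sech_pow_le hn x) (pow_nonneg (sech_pos x).le n) hx.le
    · simpa [mul_left_comm] using
        (Real.tendsto_pow_mul_exp_neg_atTop_nhds_zero 1).const_mul (2 : ℝ)
  have h := integral_Ioi_of_hasDerivAt_of_tendsto hc.continuousWithinAt
    (fun x (_ : x ∈ Set.Ioi (0 : ℝ)) => hasDerivAt_tanh_mul_sech_pow n x) (h2.sub h1) htop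
  rw [integral_sub h2 h1, integral_const_mul, integral_const_mul] at h
  simp only [Real.tanh_zero, zero_mul, sub_zero] at h
  linarith

/-- Integration by parts: `tanh x * sech x ^ n / x` is integrated against `log`. -/
lemma lam_eq_integral_log {n : ℕ} (hn : 1 ≤ n) :
    lam n = n * (∫ x in Set.Ioi (0 : ℝ), Real.log x * sech x ^ n) -
      (n + 1) * ∫ x in Set.Ioi (0 : ℝ), Real.log x * sech x ^ (n + 2) := by
  have h1 := (integrableOn_log_mul_sech_pow hn).const_mul (n : ℝ)
  have h2 := (integrableOn_log_mul_sech_pow (n := n + 2) (by omega)).const_mul ((n : ℝ) + 1)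
  have e : (fun x => Real.log x * ((n + 1) * sech x ^ (n + 2) - n * sech x ^ n)) =
      fun x => (n + 1) * (Real.log x * sech x ^ (n + 2)) - n * (Real.log x * sech x ^ n) := by
    funext x; ring
  have e' : (fun x : ℝ => x⁻¹ * (Real.tanh x * sech x ^ n)) = lamIntegrand n := by
    funext x; rw [lamIntegrand]; ring
  have hb : ∀ x, 0 < x → ‖Real.log x * (Real.tanh x * sech x ^ n)‖ ≤
      |Real.log x| * x * (2 * Real.exp (-x)) := fun x hx => by
    have h3 : 0 ≤ sech x ^ n := pow_nonneg (sech_pos x).le n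
    rw [norm_mul, Real.norm_of_nonneg (mul_nonneg (tanh_nonneg hx.le) h3), Real.norm_eq_abs,
      mul_assoc]
    exact mul_le_mul_of_nonneg_left
      (mul_le_mul (tanh_le_self hx.le) (sech_pow_le hn x) h3 hx.le) (abs_nonneg _)
  have hzero : Tendsto (fun x => Real.log x * (Real.tanh x * sech x ^ n)) (𝓝[>] 0) (𝓝 0) := by
    refine squeeze_zero_norm' (eventually_nhdsWithin_of_forall hb) ?_
    have h3 : Tendsto (fun x : ℝ => |Real.log x| * x) (𝓝[>] 0) (𝓝 0) := by
      have h4 := (tendsto_log_mul_rpow_nhdsGT_zero one_pos).abs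
      rw [abs_zero] at h4
      refine h4.congr' (eventually_nhdsWithin_of_forall fun x (hx : 0 < x) => ?_)
      rw [Real.rpow_one, abs_mul, abs_of_pos hx]
    have h4 : Continuous fun x : ℝ => 2 * Real.exp (-x) := by fun_prop
    simpa using h3.mul ((h4.tendsto 0).mono_left nhdsWithin_le_nhds)
  have htop : Tendsto (fun x => Real.log x * (Real.tanh x * sech x ^ n)) atTop (𝓝 0) := by
    refine squeeze_zero_norm' (a := fun x : ℝ => 2 * (x ^ 2 * Real.exp (-x)))
      ((eventually_ge_atTop 1).mono fun x hx => (hb x (by linarith)).trans ?_) ?_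
    · have h3 : |Real.log x| ≤ x := by
        rw [abs_of_nonneg (Real.log_nonneg hx)]
        exact Real.log_le_self (by linarith)
      have h4 : 0 ≤ x * (2 * Real.exp (-x)) := by positivity
      nlinarith
    · simpa using (Real.tendsto_pow_mul_exp_neg_atTop_nhds_zero 2).const_mul (2 : ℝ)
  have h := integral_Ioi_mul_deriv_eq_deriv_mul (a := 0) (u := Real.log) (u' := fun x => x⁻¹)
    (v := fun x => Real.tanh x * sech x ^ n)
    (v' := fun x => (n + 1) * sech x ^ (n + 2) - n * sech x ^ n)
    (fun x hx => Real.hasDerivAt_log (ne_of_gt hx))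
    (fun x _ => hasDerivAt_tanh_mul_sech_pow n x)
    (by simp only [Pi.mul_def]; rw [e]; exact h2.sub h1)
    (by simp only [Pi.mul_def]; rw [e']; exact integrableOn_lamIntegrand hn)
    hzero htop
  rw [e, e', integral_sub h2 h1, integral_const_mul, integral_const_mul, ← lam] at h
  linarith

/-! ### Differences of Hurwitz zeta functions -/

/-- The difference `ζ(s, x) - ζ(s, y)` of two Hurwitz zeta functions, an entire function of `s`. -/
noncomputable def zetaDiff (x y : ℝ) (s : ℂ) : ℂ := zetaH s x - zetaH s y

lemma differentiable_zetaDiff {x y : ℝ} (hx : 0 < x) (hy : 0 < y) :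
    Differentiable ℂ (zetaDiff x y) := by
  have hf : ∀ z : ℝ, 0 < z → Differentiable ℂ fun s : ℂ =>
      ∑ j ∈ Finset.range (⌈z⌉₊ - 1), 1 / ((j : ℂ) + ((z - (⌈z⌉₊ - 1 : ℕ) : ℝ) : ℂ)) ^ s := by
    intro z hz
    obtain ⟨h0, -⟩ := fract_part_mem hz
    refine Differentiable.fun_sum fun j _ => ?_
    have hne : (j : ℂ) + ((z - (⌈z⌉₊ - 1 : ℕ) : ℝ) : ℂ) ≠ 0 := by
      rw [← Complex.ofReal_natCast, ← Complex.ofReal_add, Complex.ofReal_ne_zero]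
      positivity
    refine Differentiable.div (by fun_prop) (differentiable_id.const_cpow (Or.inl hne)) ?_
    intro s
    rw [Ne, Complex.cpow_eq_zero_iff]
    exact fun h => hne h.1
  have h := ((HurwitzZeta.differentiable_hurwitzZeta_sub_hurwitzZeta
    (x : UnitAddCircle) (y : UnitAddCircle)).sub (hf x hx)).add (hf y hy)
  convert! h using 1
  funext u
  simp only [zetaDiff, zetaH, Pi.add_apply, Pi.sub_apply]
  ring

/-- The pole at `s = 1` included, `zetaDerivDiff` is the derivative of `zetaDiff`. -/
lemma hasDerivAt_zetaDiff {x y : ℝ} (hx : 0 < x) (hy : 0 < y) (s : ℂ) :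
    HasDerivAt (zetaDiff x y) (zetaDerivDiff s x y) s := by
  have hd := differentiable_zetaDiff hx hy
  have key : ∀ w : ℂ, w ≠ 1 → deriv (zetaDiff x y) w =
      deriv (fun u => zetaH u x) w - deriv (fun u => zetaH u y) w := fun w hw =>
    deriv_fun_sub (differentiableAt_zetaH hx hw) (differentiableAt_zetaH hy hw)
  suffices h : zetaDerivDiff s x y = deriv (zetaDiff x y) s from h ▸ (hd s).hasDerivAt
  rcases eq_or_ne s 1 with rfl | hs
  · have hc : Continuous (deriv (zetaDiff x y)) :=
      (hd.contDiff (n := 1)).continuous_deriv le_rfl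
    refine tendsto_nhds_unique (tendsto_zetaDerivDiff_one hx hy)
      ((hc.continuousAt.tendsto.mono_left nhdsWithin_le_nhds).congr' ?_)
    filter_upwards [self_mem_nhdsWithin] with w hw
    exact key w hw
  · rw [zetaDerivDiff, if_neg hs, key s hs]

lemma zetaH_add_one {x : ℝ} (hx : 0 < x) (s : ℂ) :
    zetaH s (x + 1) = zetaH s x - 1 / (x : ℂ) ^ s := by
  have h1 : 1 ≤ ⌈x⌉₊ := Nat.one_le_ceil_iff.2 hx
  have e : ⌈x + 1⌉₊ - 1 = (⌈x⌉₊ - 1) + 1 := by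
    rw [Nat.ceil_add_one hx.le]; omega
  have e2 : ((x + 1 : ℝ) : UnitAddCircle) = (x : UnitAddCircle) := AddCircle.coe_add_period 1 x
  rw [zetaH, zetaH, e, e2, Finset.sum_range_succ]
  push_cast
  have e3 : ((⌈x⌉₊ - 1 : ℕ) : ℂ) + ((x : ℂ) + 1 - (((⌈x⌉₊ - 1 : ℕ) : ℂ) + 1)) = x := by ring
  have e4 : (x : ℂ) + 1 - (((⌈x⌉₊ - 1 : ℕ) : ℂ) + 1) = x - ((⌈x⌉₊ - 1 : ℕ) : ℂ) := by ring
  rw [e3, e4]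
  ring

lemma zetaDerivDiff_add_one {x y : ℝ} (hx : 0 < x) (hy : 0 < y) (s : ℂ) :
    zetaDerivDiff s x (y + 1) =
      -zetaDerivDiff s y x - (Real.log y : ℂ) * (y : ℂ) ^ (-s) := by
  have hy0 : (y : ℂ) ≠ 0 := Complex.ofReal_ne_zero.2 hy.ne'
  have e : zetaDiff x (y + 1) = fun w => -zetaDiff y x w + (y : ℂ) ^ (-w) := by
    funext w
    simp only [zetaDiff, zetaH_add_one hy, Complex.cpow_neg]
    ring
  have h := hasDerivAt_zetaDiff hx (by positivity : 0 < y + 1) s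
  rw [e] at h
  refine h.unique ?_
  refine ((hasDerivAt_zetaDiff hy hx s).neg.add
    ((hasDerivAt_neg s).const_cpow (Or.inl hy0))).congr_deriv ?_
  rw [Complex.ofReal_log hy.le]
  ring

/-! ### The derivative at `-1` and Catalan's constant -/

lemma sinZeta_quarter_two :
    HurwitzZeta.sinZeta ((1 / 4 : ℝ) : UnitAddCircle) 2 = (catalanG : ℂ) := by
  have h := HurwitzZeta.hasSum_nat_sinZeta (1 / 4) (s := 2) (by simp)
  have hG : HasSum (fun k : ℕ => (((-1 : ℝ) ^ k / (2 * (k : ℝ) + 1) ^ 2 : ℝ) : ℂ))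
      ((catalanG : ℝ) : ℂ) := Complex.hasSum_ofReal.2 summable_catalanG.hasSum
  have hev : HasSum (fun k : ℕ => ((Real.sin (2 * Real.pi * (1 / 4) * ((2 * k : ℕ) : ℝ)) : ℝ) : ℂ) /
      (((2 * k : ℕ) : ℂ)) ^ (2 : ℂ)) 0 := by
    have e : ∀ k : ℕ, Real.sin (2 * Real.pi * (1 / 4) * ((2 * k : ℕ) : ℝ)) = 0 := fun k => by
      rw [← Real.sin_nat_mul_pi k]; congr 1; push_cast; ring
    simp only [e, Complex.ofReal_zero, zero_div]
    exact hasSum_zero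
  have hodd : HasSum (fun k : ℕ =>
      ((Real.sin (2 * Real.pi * (1 / 4) * ((2 * k + 1 : ℕ) : ℝ)) : ℝ) : ℂ) /
      (((2 * k + 1 : ℕ) : ℂ)) ^ (2 : ℂ)) (catalanG : ℂ) := by
    refine hG.congr_fun fun k => ?_
    have e : Real.sin (2 * Real.pi * (1 / 4) * ((2 * k + 1 : ℕ) : ℝ)) = (-1) ^ k := by
      have : 2 * Real.pi * (1 / 4) * ((2 * k + 1 : ℕ) : ℝ) = Real.pi / 2 + k * Real.pi := by
        push_cast; ring
      rw [this, Real.sin_add_nat_mul_pi]; simp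
    rw [e]
    rw [Complex.cpow_ofNat]
    push_cast
    rfl
  have hs := HasSum.even_add_odd (f := fun n : ℕ =>
    ((Real.sin (2 * Real.pi * (1 / 4) * (n : ℝ)) : ℝ) : ℂ) / (n : ℂ) ^ (2 : ℂ)) hev hodd
  rw [zero_add] at hs
  exact h.unique hs

lemma zetaDiff_quarter (s : ℂ) : zetaDiff (1 / 4) (3 / 4) s =
    2 * HurwitzZeta.hurwitzZetaOdd ((1 / 4 : ℝ) : UnitAddCircle) s := by
  have e1 : ⌈(1 / 4 : ℝ)⌉₊ = 1 := by rw [Nat.ceil_eq_iff] <;> norm_num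
  have e2 : ⌈(3 / 4 : ℝ)⌉₊ = 1 := by rw [Nat.ceil_eq_iff] <;> norm_num
  have e3 : ((3 / 4 : ℝ) : UnitAddCircle) = -((1 / 4 : ℝ) : UnitAddCircle) := by
    rw [← AddCircle.coe_neg, ← AddCircle.coe_add_period 1 (-(1 / 4) : ℝ)]
    norm_num
  rw [zetaDiff, zetaH, zetaH, e1, e2, e3, HurwitzZeta.hurwitzZetaOdd_eq]
  simp
  ring

/-- Differentiation of the functional equation of the odd Hurwitz zeta function at `s = 2`, where
its factor `sin (π s / 2)` vanishes. -/
lemma zetaDerivDiff_neg_one_quarter :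
    zetaDerivDiff (-1) (1 / 4) (3 / 4) = (catalanG : ℂ) / (2 * Real.pi) := by
  have hpi : (Real.pi : ℂ) ≠ 0 := Complex.ofReal_ne_zero.2 Real.pi_ne_zero
  let g : ℂ → ℂ := fun s => 4 * (2 * Real.pi : ℂ) ^ (-s) * Complex.Gamma s *
    HurwitzZeta.sinZeta ((1 / 4 : ℝ) : UnitAddCircle) s
  have hg : DifferentiableAt ℂ g 2 := by
    have h1 : DifferentiableAt ℂ (fun s : ℂ => (2 * Real.pi : ℂ) ^ (-s)) 2 :=
      differentiable_neg.differentiableAt.const_cpow (Or.inl (by simp [hpi]))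
    have h2 : DifferentiableAt ℂ Complex.Gamma 2 :=
      Complex.differentiableAt_Gamma _ fun m h => by
        have := congrArg Complex.re h
        simp at this
        have h3 : (0 : ℝ) ≤ m := m.cast_nonneg
        linarith
    exact ((h1.const_mul 4).mul h2).mul
      (HurwitzZeta.differentiableAt_sinZeta _).differentiableAt
  have hsin : HasDerivAt (fun s : ℂ => Complex.sin (Real.pi * s / 2)) (-(Real.pi / 2 : ℂ)) 2 := by
    have h1 : HasDerivAt (fun s : ℂ => Real.pi * s / 2) (Real.pi / 2 : ℂ) 2 := by
      simpa using ((hasDerivAt_id (2 : ℂ)).const_mul (Real.pi : ℂ)).div_const 2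
    have h2 := h1.csin
    rw [mul_div_cancel_right₀ _ (two_ne_zero), Complex.cos_pi] at h2
    simpa using h2
  have hR := hg.hasDerivAt.mul hsin
  have hL : HasDerivAt (fun s : ℂ => zetaDiff (1 / 4) (3 / 4) (1 - s))
      (-zetaDerivDiff (-1) (1 / 4) (3 / 4)) 2 := by
    have h1 : HasDerivAt (zetaDiff (1 / 4) (3 / 4)) (zetaDerivDiff (-1) (1 / 4) (3 / 4))
        (1 - 2) := by
      rw [show (1 - 2 : ℂ) = -1 by norm_num]
      exact hasDerivAt_zetaDiff (by norm_num) (by norm_num) _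
    exact (h1.comp (2 : ℂ) ((hasDerivAt_id (2 : ℂ)).const_sub 1)).congr_deriv (by ring)
  have hEq : (fun s : ℂ => zetaDiff (1 / 4) (3 / 4) (1 - s)) =ᶠ[𝓝 2]
      g * fun s : ℂ => Complex.sin (Real.pi * s / 2) := by
    have h0 : ∀ᶠ s : ℂ in 𝓝 2, 0 < s.re :=
      Complex.continuous_re.continuousAt.eventually_const_lt (by simp)
    filter_upwards [h0] with s hs
    rw [zetaDiff_quarter, HurwitzZeta.hurwitzZetaOdd_one_sub]
    · simp only [Pi.mul_apply, g]; ring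
    · rintro n rfl
      simp at hs
      have h3 : (0 : ℝ) ≤ n := n.cast_nonneg
      linarith
  have h := hL.unique (hR.congr_of_eventuallyEq hEq)
  have hs2 : Complex.sin (Real.pi * 2 / 2) = 0 := by
    rw [mul_div_cancel_right₀ _ (two_ne_zero), Complex.sin_pi]
  have hG2 : Complex.Gamma 2 = 1 := by
    have := Complex.Gamma_nat_eq_factorial 1
    rwa [Nat.cast_one, one_add_one_eq_two, Nat.factorial_one, Nat.cast_one] at this
  have hp : (2 * Real.pi : ℂ) ^ (-2 : ℂ) = ((2 * Real.pi : ℂ) ^ 2)⁻¹ := by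
    rw [Complex.cpow_neg, show (2 : ℂ) = ((2 : ℕ) : ℂ) by norm_num, Complex.cpow_natCast]
  rw [hs2, mul_zero, zero_add] at h
  simp only [g] at h
  rw [hp, hG2, sinZeta_quarter_two] at h
  rw [← neg_inj, h]
  field_simp
  norm_num

/-! ### The Mellin transform as a combination of Hurwitz zeta functions -/

/-- The alternating series `∑ (-1)^j (j + x)^(-w)`, split into even and odd `j`. -/
lemma hasSum_alternating {x : ℝ} (hx : 0 < x) {w : ℂ} (hw : 1 < w.re) :
    HasSum (fun j : ℕ => (-1 : ℂ) ^ j * (1 / ((j : ℂ) + (x : ℂ)) ^ w))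
      ((2 : ℂ) ^ (-w) * zetaDiff (x / 2) (x / 2 + 1 / 2) w) := by
  have h2 : ∀ y : ℝ, 0 < y → ∀ k : ℕ,
      (2 : ℂ) ^ (-w) * (1 / ((k : ℂ) + (y : ℂ)) ^ w) = 1 / ((2 * k : ℂ) + ((2 * y : ℝ) : ℂ)) ^ w := by
    intro y hy k
    have e : (2 * k : ℂ) + ((2 * y : ℝ) : ℂ) = ((2 : ℝ) : ℂ) * ((k + y : ℝ) : ℂ) := by
      push_cast; ring
    rw [e, Complex.mul_cpow_ofReal_nonneg (by norm_num) (by positivity), Complex.cpow_neg]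
    push_cast
    rw [one_div, one_div, mul_inv]
  have hev := (hasSum_zetaH (by positivity : 0 < x / 2) hw).mul_left ((2 : ℂ) ^ (-w))
  have hod := ((hasSum_zetaH (by positivity : 0 < x / 2 + 1 / 2) hw).mul_left
    ((2 : ℂ) ^ (-w))).neg
  simp only [h2 _ (by positivity : 0 < x / 2)] at hev
  simp only [h2 _ (by positivity : 0 < x / 2 + 1 / 2)] at hod
  have := HasSum.even_add_odd (f := fun j : ℕ => (-1 : ℂ) ^ j * (1 / ((j : ℂ) + (x : ℂ)) ^ w))
    (hev.congr_fun fun k => ?_) (hod.congr_fun fun k => ?_)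
  · convert this using 1
    rw [zetaDiff]; ring
  · rw [pow_mul, neg_one_sq, one_pow, one_mul]
    push_cast
    ring_nf
  · rw [pow_succ, pow_mul, neg_one_sq, one_pow, one_mul]
    push_cast
    ring_nf

/-- The entire function `Γ(s)⁻¹ ∫ x^(s-1) sech^(m+1) x dx`, as a combination of Hurwitz zeta
functions. -/
noncomputable def sechZeta (m : ℕ) (s : ℂ) : ℂ :=
  (2 : ℂ) ^ (2 * (m : ℂ) + 1 - 2 * s) / (m.factorial : ℂ) *
    ∑ k ∈ Finset.range (m + 1), (-(1 / 2) : ℂ) ^ k * stirlingP k m (((m : ℂ) + 1) / 2) *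
      zetaDiff (((m : ℝ) + 1) / 4) (((m : ℝ) + 3) / 4) (s - m + k)

lemma differentiable_sechZeta (m : ℕ) : Differentiable ℂ (sechZeta m) := by
  have h := differentiable_zetaDiff (x := ((m : ℝ) + 1) / 4) (y := ((m : ℝ) + 3) / 4)
    (by positivity) (by positivity)
  refine Differentiable.mul (Differentiable.div_const
    (Differentiable.const_cpow (by fun_prop) (Or.inl two_ne_zero)) _) ?_
  refine Differentiable.fun_sum fun k _ => Differentiable.const_mul ?_ _
  exact h.comp (f := fun s : ℂ => s - m + k) (by fun_prop)

lemma factorial_mul_choose (m j : ℕ) : ((m.factorial : ℂ)) * ((j + m).choose m : ℂ) =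
    (ascPochhammer ℂ m).eval ((j : ℂ) + 1) := by
  rw [← Nat.cast_mul, ← Nat.ascFactorial_eq_factorial_mul_choose,
    ← ascPochhammer_nat_eq_ascFactorial]
  have := ascPochhammer_eval_cast (S := ℂ) m (j + 1)
  rw [this]; push_cast; rfl

lemma hasSum_sechZeta (m : ℕ) {s : ℂ} (hs : (m : ℝ) + 1 < s.re) :
    HasSum (fun j : ℕ => ((2 : ℂ) ^ (m + 1) * ((-1) ^ j * ((j + m).choose m : ℂ))) /
      ((2 * (j : ℝ) + (m + 1) : ℝ) : ℂ) ^ s) (sechZeta m s) := by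
  have hm : (m.factorial : ℂ) ≠ 0 := Nat.cast_ne_zero.2 m.factorial_ne_zero
  have h : ∀ k ∈ Finset.range (m + 1), HasSum (fun j : ℕ =>
      (-1) ^ k * stirlingP k m (((m : ℂ) + 1) / 2) *
        ((-1 : ℂ) ^ j * (1 / ((j : ℂ) + (((m + 1) / 2 : ℝ) : ℂ)) ^ (s - m + k))))
      ((-1) ^ k * stirlingP k m (((m : ℂ) + 1) / 2) * ((2 : ℂ) ^ (-(s - m + k)) *
        zetaDiff (((m : ℝ) + 1) / 4) (((m : ℝ) + 3) / 4) (s - m + k))) := by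
    intro k _
    have hw : 1 < (s - m + k).re := by
      simp only [Complex.add_re, Complex.sub_re, Complex.natCast_re]
      have : (0 : ℝ) ≤ k := k.cast_nonneg
      linarith
    have h1 := hasSum_alternating (by positivity : (0 : ℝ) < ((m : ℝ) + 1) / 2) hw
    rw [show ((m : ℝ) + 1) / 2 / 2 = (m + 1) / 4 by ring,
      show ((m : ℝ) + 1) / 4 + 1 / 2 = (m + 3) / 4 by ring] at h1
    exact h1.mul_left _
  have hsum := (hasSum_sum h).mul_left ((2 : ℂ) ^ ((m : ℂ) + 1 - s) / (m.factorial : ℂ))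
  convert! hsum using 1
  · funext j
    have hj : (0 : ℝ) < (j : ℝ) + (m + 1) / 2 := by positivity
    have hj0 : ((j : ℂ) + (((m + 1) / 2 : ℝ) : ℂ)) ≠ 0 := by
      rw [← Complex.ofReal_natCast, ← Complex.ofReal_add]
      exact Complex.ofReal_ne_zero.2 hj.ne'
    have e1 : ((2 * (j : ℝ) + (m + 1) : ℝ) : ℂ) ^ s =
        (2 : ℂ) ^ s * ((j : ℂ) + (((m + 1) / 2 : ℝ) : ℂ)) ^ s := by
      have e : ((2 * (j : ℝ) + (m + 1) : ℝ) : ℂ) = ((2 : ℝ) : ℂ) * ((j + (m + 1) / 2 : ℝ) : ℂ) := by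
        push_cast; ring
      rw [e, Complex.mul_cpow_ofReal_nonneg (by norm_num) hj.le]
      push_cast
      rfl
    have e2 : (2 : ℂ) ^ ((m : ℂ) + 1 - s) = 2 ^ (m + 1) / 2 ^ s := by
      rw [Complex.cpow_sub _ _ two_ne_zero, ← Nat.cast_succ, Complex.cpow_natCast]
    have e3 : ((j + m).choose m : ℂ) = (∑ k ∈ Finset.range (m + 1),
        (-1) ^ k * stirlingP k m (((m : ℂ) + 1) / 2) *
          ((j : ℂ) + (((m + 1) / 2 : ℝ) : ℂ)) ^ (m - k)) / (m.factorial : ℂ) := by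
      rw [eq_div_iff hm, mul_comm, factorial_mul_choose, sum_stirlingP m (((m : ℂ) + 1) / 2)]
      push_cast
      rfl
    have e4 : ∀ k ∈ Finset.range (m + 1), (1 : ℂ) /
        ((j : ℂ) + (((m + 1) / 2 : ℝ) : ℂ)) ^ (s - m + k) =
        ((j : ℂ) + (((m + 1) / 2 : ℝ) : ℂ)) ^ (m - k) /
          ((j : ℂ) + (((m + 1) / 2 : ℝ) : ℂ)) ^ s := by
      intro k hk
      have hk : k ≤ m := Nat.lt_succ_iff.1 (Finset.mem_range.1 hk)
      have : s - m + k = s - ((m - k : ℕ) : ℂ) := by rw [Nat.cast_sub hk]; ring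
      rw [this, Complex.cpow_sub _ _ hj0, Complex.cpow_natCast, one_div_div]
    rw [e1, e2, e3, Finset.sum_div, Finset.mul_sum, Finset.mul_sum, Finset.mul_sum,
      Finset.sum_div]
    refine Finset.sum_congr rfl fun k hk => ?_
    rw [e4 k hk]
    field_simp
  · rw [sechZeta, Finset.mul_sum, Finset.mul_sum]
    refine Finset.sum_congr rfl fun k _ => ?_
    have e1 : (2 : ℂ) ^ (2 * (m : ℂ) + 1 - 2 * s) * (-(1 / 2)) ^ k =
        (2 : ℂ) ^ ((m : ℂ) + 1 - s) * ((-1) ^ k * (2 : ℂ) ^ (-(s - m + k))) := by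
      have : 2 * (m : ℂ) + 1 - 2 * s = ((m : ℂ) + 1 - s) + (-(s - m + k)) + k := by ring
      rw [this, Complex.cpow_add _ _ two_ne_zero, Complex.cpow_add _ _ two_ne_zero,
        Complex.cpow_natCast, neg_pow (1 / 2 : ℂ), one_div, inv_pow]
      field_simp
    linear_combination (stirlingP k m (((m : ℂ) + 1) / 2) *
      zetaDiff (((m : ℝ) + 1) / 4) (((m : ℝ) + 3) / 4) (s - m + k) / (m.factorial : ℂ)) * e1

lemma hasSum_sechPow (m : ℕ) {t : ℝ} (ht : 0 < t) :
    HasSum (fun j : ℕ => ((2 : ℂ) ^ (m + 1) * ((-1) ^ j * ((j + m).choose m : ℂ))) *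
      (Real.exp (-(2 * (j : ℝ) + (m + 1)) * t) : ℂ)) (sechPow (m + 1) t) := by
  have hr : ‖-Real.exp (-2 * t)‖ < 1 := by
    rw [norm_neg, Real.norm_of_nonneg (Real.exp_pos _).le, Real.exp_lt_one_iff]
    linarith
  have h := (hasSum_choose_mul_geometric_of_norm_lt_one m hr).mul_left
    (2 ^ (m + 1) * Real.exp (-((m + 1) * t)))
  have hv : 2 ^ (m + 1) * Real.exp (-((m + 1) * t)) * (1 / (1 - -Real.exp (-2 * t)) ^ (m + 1)) =
      sech t ^ (m + 1) := by
    have e : Real.exp (-((m + 1) * t)) = Real.exp (-t) ^ (m + 1) := by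
      rw [← Real.exp_nat_mul]; congr 1; push_cast; ring
    rw [e, ← mul_pow, one_div, ← inv_pow, ← mul_pow, sech, Real.cosh_eq]
    congr 1
    have e2 : Real.exp (-2 * t) = Real.exp (-t) * Real.exp (-t) := by
      rw [← Real.exp_add]; congr 1; ring
    have e3 : Real.exp t = (Real.exp (-t))⁻¹ := by rw [Real.exp_neg, inv_inv]
    have := Real.exp_pos (-t)
    rw [e2, e3, sub_neg_eq_add]
    field_simp
  rw [hv] at h
  refine (Complex.hasSum_ofReal.2 h).congr_fun fun j => ?_
  have e : Real.exp (-(2 * (j : ℝ) + (m + 1)) * t) =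
      Real.exp (-((m + 1) * t)) * Real.exp (-2 * t) ^ j := by
    rw [← Real.exp_nat_mul, ← Real.exp_add]; congr 1; ring
  rw [e, neg_pow (Real.exp (-2 * t))]
  push_cast
  ring

/-- Termwise integration of `sech^(m+1) t = 2^(m+1) ∑ (-1)^j C(j+m, m) exp (-(2j+m+1) t)`. -/
lemma mellin_sechPow_of_lt_re (m : ℕ) {s : ℂ} (hs : (m : ℝ) + 1 < s.re) :
    mellin (sechPow (m + 1)) s = Complex.Gamma s * sechZeta m s := by
  have hm0 : (0 : ℝ) ≤ m := m.cast_nonneg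
  have hs0 : s ≠ 0 := by rintro rfl; simp at hs; linarith
  have hsum := hasSum_sechZeta m hs
  have h := hasSum_mellin (ι := ℕ)
    (a := fun j => (2 : ℂ) ^ (m + 1) * ((-1) ^ j * ((j + m).choose m : ℂ)))
    (p := fun j => 2 * (j : ℝ) + (m + 1)) (F := sechPow (m + 1)) (s := s)
    (fun j => Or.inr (by positivity)) (by linarith)
    (fun t ht => hasSum_sechPow m ht)
    (by
      refine hsum.summable.norm.congr fun j => ?_
      rw [norm_div, Complex.norm_cpow_eq_rpow_re_of_pos (by positivity)])
  refine h.unique ((hsum.mul_left (Complex.Gamma s)).congr_fun fun j => ?_)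
  rw [mul_div_assoc]

/-- The identity theorem extends the formula to the half-plane of convergence. -/
theorem mellin_sechPow (m : ℕ) {s : ℂ} (hs : 0 < s.re) :
    mellin (sechPow (m + 1)) s = Complex.Gamma s * sechZeta m s := by
  let U : Set ℂ := {s | 0 < s.re}
  have hU : IsOpen U := isOpen_lt continuous_const Complex.continuous_re
  have hf : AnalyticOnNhd ℂ (mellin (sechPow (m + 1))) U :=
    DifferentiableOn.analyticOnNhd (fun w hw => (mellin_sechPow_hasDerivAt (by omega)
      hw).2.differentiableAt.differentiableWithinAt) hU
  have hg : AnalyticOnNhd ℂ (fun w => Complex.Gamma w * sechZeta m w) U := by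
    refine DifferentiableOn.analyticOnNhd (fun w hw => ?_) hU
    refine ((Complex.differentiableAt_Gamma w fun k hk => ?_).mul
      (differentiable_sechZeta m w)).differentiableWithinAt
    have h1 : 0 < w.re := hw
    rw [hk] at h1
    simp at h1
    have : (0 : ℝ) ≤ k := k.cast_nonneg
    linarith
  have hz : (((m : ℝ) + 2 : ℝ) : ℂ) ∈ U := by
    change 0 < (((m : ℝ) + 2 : ℝ) : ℂ).re
    rw [Complex.ofReal_re]; positivity
  refine hf.eqOn_of_preconnected_of_eventuallyEq hg
    (convex_halfSpace_re_gt 0).isPreconnected hz ?_ hs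
  have h0 : ∀ᶠ w : ℂ in 𝓝 (((m : ℝ) + 2 : ℝ) : ℂ), (m : ℝ) + 1 < w.re :=
    Complex.continuous_re.continuousAt.eventually_const_lt (by rw [Complex.ofReal_re]; linarith)
  filter_upwards [h0] with w hw
  exact mellin_sechPow_of_lt_re m hw

/-! ### Values of the generalized Stirling polynomials -/

lemma stirlingP_zero (m : ℕ) (x : ℂ) : stirlingP 0 m x = 1 := by
  have h := (monic_ascPochhammer ℂ m).comp_X_add_C (1 - x)
  have hd : ((ascPochhammer ℂ m).comp (Polynomial.X + Polynomial.C (1 - x))).natDegree = m := by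
    rw [Polynomial.natDegree_comp, ascPochhammer_natDegree, Polynomial.natDegree_X_add_C, mul_one]
  rw [Polynomial.Monic, Polynomial.leadingCoeff, hd] at h
  rw [stirlingP, pow_zero, one_mul, Nat.sub_zero, h]

/-- The rising factorial `(y - (m - 1) / 2)_m` has the parity of `m` as a polynomial in `y`. -/
lemma stirlingP_eq_zero_of_odd {k m : ℕ} (hk : Odd k) (hkm : k ≤ m) :
    stirlingP k m (((m : ℂ) + 1) / 2) = 0 := by
  set p := (ascPochhammer ℂ m).comp (Polynomial.X + Polynomial.C (1 - ((m : ℂ) + 1) / 2)) with hp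
  have h : p.comp (Polynomial.C (-1) * Polynomial.X) = Polynomial.C ((-1) ^ m) * p := by
    refine Polynomial.funext fun y => ?_
    simp only [hp, Polynomial.eval_comp, Polynomial.eval_add,
      Polynomial.eval_X, Polynomial.eval_C, Polynomial.eval_mul]
    rw [show -1 * y + (1 - ((m : ℂ) + 1) / 2) = -(y - (1 - ((m : ℂ) + 1) / 2)) by ring,
      ascPochhammer_eval_neg_eq_descPochhammer, descPochhammer_eval_eq_ascPochhammer]
    congr 2
    ring
  have h2 := congrArg (fun q => q.coeff (m - k)) h
  simp only [Polynomial.coeff_C_mul, Polynomial.comp_C_mul_X_coeff] at h2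
  have h3 : (-1 : ℂ) ^ m = -(-1) ^ (m - k) := by
    conv_lhs => rw [← Nat.sub_add_cancel hkm, pow_add, hk.neg_one_pow]
    ring
  have h4 : (-1 : ℂ) ^ (m - k) ≠ 0 := pow_ne_zero _ (by norm_num)
  rw [h3] at h2
  have h5 : p.coeff (m - k) = 0 := by
    have : (-1 : ℂ) ^ (m - k) * (2 * p.coeff (m - k)) = 0 := by linear_combination h2
    simpa [h4] using this
  rw [stirlingP, ← hp, h5, mul_zero]

lemma stirlingP_two_two : stirlingP 2 2 (3 / 2) = -(1 / 4) := by
  rw [stirlingP, Nat.sub_self, Polynomial.coeff_zero_eq_eval_zero, Polynomial.eval_comp]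
  simp [ascPochhammer_succ_right]
  norm_num

/-! ### The integrals `lam n` as combinations of derivatives of Hurwitz zeta functions -/

/-- The part of the derivative of `sechZeta m` at `1` in which the zeta functions are
differentiated. -/
noncomputable def sechZetaDeriv (m : ℕ) : ℂ :=
  (2 : ℂ) ^ (2 * (m : ℤ) - 1) / (m.factorial : ℂ) *
    ∑ k ∈ Finset.range (m + 1), (-(1 / 2) : ℂ) ^ k * stirlingP k m (((m : ℂ) + 1) / 2) *
      zetaDerivDiff ((k : ℂ) - (m : ℂ) + 1) (((m : ℝ) + 1) / 4) (((m : ℝ) + 3) / 4)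

lemma hasDerivAt_sechZeta (m : ℕ) :
    HasDerivAt (sechZeta m) (-2 * Complex.log 2 * sechZeta m 1 + sechZetaDeriv m) 1 := by
  have h1 : HasDerivAt (fun s : ℂ => (2 : ℂ) ^ (2 * (m : ℂ) + 1 - 2 * s))
      ((2 : ℂ) ^ (2 * (m : ℂ) + 1 - 2 * 1) * Complex.log 2 * (-(2 * 1))) 1 :=
    (((hasDerivAt_id (1 : ℂ)).const_mul 2).const_sub _).const_cpow (Or.inl two_ne_zero)
  have h2 : ∀ k ∈ Finset.range (m + 1), HasDerivAt (fun s : ℂ =>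
      (-(1 / 2) : ℂ) ^ k * stirlingP k m (((m : ℂ) + 1) / 2) *
        zetaDiff (((m : ℝ) + 1) / 4) (((m : ℝ) + 3) / 4) (s - m + k))
      ((-(1 / 2) : ℂ) ^ k * stirlingP k m (((m : ℂ) + 1) / 2) *
        zetaDerivDiff ((k : ℂ) - (m : ℂ) + 1) (((m : ℝ) + 1) / 4) (((m : ℝ) + 3) / 4)) 1 := by
    intro k _
    have h := hasDerivAt_zetaDiff (x := ((m : ℝ) + 1) / 4) (y := ((m : ℝ) + 3) / 4)
      (by positivity) (by positivity) ((k : ℂ) - (m : ℂ) + 1)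
    rw [show (k : ℂ) - m + 1 = 1 - m + k by ring] at h ⊢
    exact (h.comp_add_const (1 - m : ℂ) k).comp_sub_const (1 : ℂ) m |>.const_mul _
  refine ((h1.div_const (m.factorial : ℂ)).mul (HasDerivAt.fun_sum h2)).congr_deriv ?_
  have e : (2 : ℂ) ^ (2 * (m : ℂ) + 1 - 2 * 1) = (2 : ℂ) ^ (2 * (m : ℤ) - 1) := by
    rw [← Complex.cpow_intCast]
    push_cast
    ring_nf
  rw [sechZetaDeriv, sechZeta, e]
  ring

/-- `lam n` is the value at `s = 1` of the derivative of the Mellin transform of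
`n sech^n - (n + 1) sech^(n+2)`, which itself vanishes there; hence neither the derivative of the
Gamma factor nor that of the power of two contributes. -/
theorem mul_lam_succ (m : ℕ) :
    (((m : ℝ) + 1) * lam (m + 1) : ℝ) = ((m : ℂ) + 1) ^ 2 * sechZetaDeriv m -
      ((m : ℂ) + 1) * ((m : ℂ) + 2) * sechZetaDeriv (m + 2) := by
  have hn : 1 ≤ m + 1 := by omega
  have h1 := (mellin_sechPow_hasDerivAt hn (s := 1) (by simp)).2
  have h2 := (mellin_sechPow_hasDerivAt (n := m + 3) (by omega) (s := 1) (by simp)).2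
  rw [mellin_log_sechPow_one] at h1 h2
  have hH := (h1.const_mul (((m : ℂ) + 1) ^ 2)).sub
    (h2.const_mul (((m : ℂ) + 1) * ((m : ℂ) + 2)))
  have hΓ : DifferentiableAt ℂ Complex.Gamma 1 :=
    Complex.differentiableAt_Gamma _ fun k h => by
      have := congrArg Complex.re h
      simp at this
      have h3 : (0 : ℝ) ≤ k := k.cast_nonneg
      linarith
  have hE := ((hasDerivAt_sechZeta m).const_mul (((m : ℂ) + 1) ^ 2)).sub
    ((hasDerivAt_sechZeta (m + 2)).const_mul (((m : ℂ) + 1) * ((m : ℂ) + 2)))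
  have hP := hΓ.hasDerivAt.mul hE
  have hE1 : ((m : ℂ) + 1) ^ 2 * sechZeta m 1 -
      ((m : ℂ) + 1) * ((m : ℂ) + 2) * sechZeta (m + 2) 1 = 0 := by
    have e1 := mellin_sechPow m (s := 1) (by simp)
    have e2 := mellin_sechPow (m + 2) (s := 1) (by simp)
    rw [mellin_sechPow_one, Complex.Gamma_one, one_mul] at e1 e2
    have e3 := congrArg (fun x : ℝ => (x : ℂ)) (mul_integral_sech_pow hn)
    push_cast at e3
    rw [← e1, ← e2]
    linear_combination ((m : ℂ) + 1) * e3
  have hEq : (fun s => ((m : ℂ) + 1) ^ 2 * mellin (sechPow (m + 1)) s) -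
      (fun s => ((m : ℂ) + 1) * ((m : ℂ) + 2) * mellin (sechPow (m + 3)) s) =ᶠ[𝓝 1]
      Complex.Gamma * ((fun s => ((m : ℂ) + 1) ^ 2 * sechZeta m s) -
        fun s => ((m : ℂ) + 1) * ((m : ℂ) + 2) * sechZeta (m + 2) s) := by
    have h0 : ∀ᶠ s : ℂ in 𝓝 1, 0 < s.re :=
      Complex.continuous_re.continuousAt.eventually_const_lt (by simp)
    filter_upwards [h0] with s hs
    simp only [Pi.sub_apply, Pi.mul_apply]
    rw [mellin_sechPow m hs, mellin_sechPow (m + 2) hs]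
    ring
  have h := hH.unique (hP.congr_of_eventuallyEq hEq)
  have hl := congrArg (fun x : ℝ => (x : ℂ)) (lam_eq_integral_log hn)
  push_cast at hl h ⊢
  simp only [Pi.sub_apply, Complex.Gamma_one] at h
  linear_combination ((m : ℂ) + 1) * hl + h +
    (deriv Complex.Gamma 1 - 2 * Complex.log 2) * hE1

lemma mul_sechZetaDeriv_add_two (N : ℕ) :
    ((N : ℂ) + 1) * ((N : ℂ) + 2) * sechZetaDeriv (N + 2) =
      (2 : ℂ) ^ (2 * N + 3) / (N.factorial : ℂ) *
        ∑ k ∈ Finset.range (N + 3), (-(1 / 2) : ℂ) ^ k *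
          stirlingP k (N + 2) (((N : ℂ) + 3) / 2) *
          zetaDerivDiff ((k : ℂ) - (N : ℂ) - 1) (((N : ℝ) + 3) / 4) (((N : ℝ) + 5) / 4) := by
  have e1 : (2 : ℂ) ^ (2 * ((N + 2 : ℕ) : ℤ) - 1) = 2 ^ (2 * N + 3) := by
    rw [← zpow_natCast]; congr 1; push_cast; ring
  have e2 : ((N + 2).factorial : ℂ) = ((N : ℂ) + 1) * ((N : ℂ) + 2) * N.factorial := by
    rw [Nat.factorial_succ, Nat.factorial_succ]; push_cast; ring
  have h0 : (N.factorial : ℂ) ≠ 0 := Nat.cast_ne_zero.2 N.factorial_ne_zero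
  have h1 : (N : ℂ) + 1 ≠ 0 := Nat.cast_add_one_ne_zero N
  have h2 : (N : ℂ) + 2 ≠ 0 := by exact_mod_cast (by omega : N + 2 ≠ 0)
  rw [sechZetaDeriv, e1, e2, ← mul_assoc]
  congr 1
  · field_simp
  · refine Finset.sum_congr rfl fun k _ => ?_
    push_cast
    rw [show (N : ℂ) + 2 + 1 = N + 3 by ring, show (N : ℝ) + 2 + 1 = N + 3 by ring,
      show (N : ℝ) + 2 + 3 = N + 5 by ring, show (k : ℂ) - (N + 2) + 1 = k - N - 1 by ring]

lemma lam_one : lam 1 = 4 * catalanG / Real.pi := by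
  have h := mul_lam_succ 0
  have h2 := mul_sechZetaDeriv_add_two 0
  have hodd : stirlingP 1 2 (3 / 2) = 0 := by
    have := stirlingP_eq_zero_of_odd (k := 1) (m := 2) odd_one (by norm_num)
    norm_num at this
    exact this
  have hd1 := zetaDerivDiff_add_one (x := 3 / 4) (y := 1 / 4) (by norm_num) (by norm_num) (-1)
  have hd2 := zetaDerivDiff_add_one (x := 3 / 4) (y := 1 / 4) (by norm_num) (by norm_num) 1
  have hG := zetaDerivDiff_neg_one_quarter
  have hpi : (Real.pi : ℂ) ≠ 0 := Complex.ofReal_ne_zero.2 Real.pi_ne_zero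
  rw [neg_neg, Complex.cpow_one] at hd1
  rw [Complex.cpow_neg_one] at hd2
  rw [show (1 / 4 + 1 : ℝ) = 5 / 4 by norm_num] at hd1 hd2
  simp only [Nat.cast_zero, zero_add] at h h2
  rw [h2, sechZetaDeriv] at h
  simp only [Finset.sum_range_succ, Finset.sum_range_zero, zero_add, stirlingP_zero, hodd,
    stirlingP_two_two, Nat.cast_zero, Nat.cast_one, Nat.cast_ofNat, mul_zero, zero_mul] at h
  norm_num at h hd1 hd2 hG
  rw [hd1, hd2, hG] at h
  apply Complex.ofReal_injective
  push_cast
  rw [h]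
  field_simp
  ring

lemma chi_eq_mul_lam {n : ℕ} (hn : 1 ≤ n) :
    (chi n : ℂ) = -(4 * (catalanG : ℂ) / (Real.pi : ℂ)) + ((n * lam n : ℝ) : ℂ) := by
  rw [chi_eq hn, lam_one]
  push_cast
  ring

/-! ### Separation of the two parities -/

lemma sum_range_two_mul_add_one {f : ℕ → ℂ} (n : ℕ) (hf : ∀ k, Odd k → k ≤ 2 * n → f k = 0) :
    ∑ k ∈ Finset.range (2 * n + 1), f k = ∑ k ∈ Finset.range (n + 1), f (2 * k) := by
  induction n with
  | zero => simp
  | succ n ih =>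
    rw [show 2 * (n + 1) + 1 = 2 * n + 1 + 1 + 1 by ring, Finset.sum_range_succ,
      Finset.sum_range_succ, ih fun k hk hkn => hf k hk (by omega),
      hf (2 * n + 1) (odd_two_mul_add_one n) (by omega), Finset.sum_range_succ _ (n + 1), add_zero]
    rfl

lemma neg_half_pow_two_mul (k : ℕ) : (-(1 / 2) : ℂ) ^ (2 * k) = 1 / 4 ^ k := by
  rw [pow_mul, ← one_div_pow]; norm_num

/-! ### Odd and even indices -/

lemma sechZetaDeriv_two_mul (n : ℕ) :
    sechZetaDeriv (2 * n) = (2 : ℂ) ^ (4 * (n : ℤ) - 1) / ((2 * n).factorial : ℂ) *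
      ∑ k ∈ Finset.range (n + 1), 1 / (4 : ℂ) ^ k *
        stirlingP (2 * k) (2 * n) ((2 * (n : ℂ) + 1) / 2) *
        zetaDerivDiff (-2 * (n : ℂ) + 2 * (k : ℂ) + 1)
          ((2 * (n : ℝ) + 1) / 4) ((2 * (n : ℝ) + 3) / 4) := by
  rw [sechZetaDeriv, sum_range_two_mul_add_one]
  · push_cast
    congr 1
    · congr 2; ring
    · refine Finset.sum_congr rfl fun k _ => ?_
      rw [neg_half_pow_two_mul, show 2 * (k : ℂ) - 2 * n + 1 = -2 * n + 2 * k + 1 by ring]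
  · intro k hk hkn
    rw [stirlingP_eq_zero_of_odd hk hkn]
    ring

lemma mul_sechZetaDeriv_two_mul_add_two (n : ℕ) :
    (2 * (n : ℂ) + 1) * (2 * (n : ℂ) + 2) * sechZetaDeriv (2 * n + 2) =
      (2 : ℂ) ^ (4 * n + 3) / ((2 * n).factorial : ℂ) *
        ∑ k ∈ Finset.range (n + 2), 1 / (4 : ℂ) ^ k *
          stirlingP (2 * k) (2 * n + 2) ((2 * (n : ℂ) + 3) / 2) *
          zetaDerivDiff (-2 * (n : ℂ) + 2 * (k : ℂ) - 1)
            ((2 * (n : ℝ) + 3) / 4) ((2 * (n : ℝ) + 5) / 4) := by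
  have h := mul_sechZetaDeriv_add_two (2 * n)
  rw [show 2 * n + 3 = 2 * (n + 1) + 1 by ring, sum_range_two_mul_add_one] at h
  · push_cast at h
    rw [h]
    congr 1
    · congr 2; ring
    · refine Finset.sum_congr rfl fun k _ => ?_
      rw [neg_half_pow_two_mul, show 2 * (k : ℂ) - 2 * n - 1 = -2 * n + 2 * k - 1 by ring]
  · intro k hk hkn
    have := stirlingP_eq_zero_of_odd (m := 2 * n + 2) hk (by omega)
    push_cast at this ⊢
    rw [show (2 * (n : ℂ) + 2 + 1) / 2 = (2 * n + 3) / 2 by ring] at this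
    rw [this]
    ring

lemma mul_lam_odd (n : ℕ) : (((2 * n + 1 : ℕ) * lam (2 * n + 1) : ℝ) : ℂ) =
    (2 : ℂ) ^ (4 * (n : ℤ) - 1) * (2 * (n : ℂ) + 1) ^ 2 / ((2 * n).factorial : ℂ) *
      ∑ k ∈ Finset.range (n + 1), 1 / (4 : ℂ) ^ k *
        stirlingP (2 * k) (2 * n) ((2 * (n : ℂ) + 1) / 2) *
        zetaDerivDiff (-2 * (n : ℂ) + 2 * (k : ℂ) + 1)
          ((2 * (n : ℝ) + 1) / 4) ((2 * (n : ℝ) + 3) / 4)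
    - (2 : ℂ) ^ (4 * n + 3) / ((2 * n).factorial : ℂ) *
      ∑ k ∈ Finset.range (n + 2), 1 / (4 : ℂ) ^ k *
        stirlingP (2 * k) (2 * n + 2) ((2 * (n : ℂ) + 3) / 2) *
        zetaDerivDiff (-2 * (n : ℂ) + 2 * (k : ℂ) - 1)
          ((2 * (n : ℝ) + 3) / 4) ((2 * (n : ℝ) + 5) / 4) := by
  have h := mul_lam_succ (2 * n)
  rw [← mul_sechZetaDeriv_two_mul_add_two]
  push_cast at h ⊢
  rw [h, sechZetaDeriv_two_mul]
  ring

/-- The shift `ζ(s, n/2 + 1) = ζ(s, n/2) - (n/2)^(-s)` brings all but one of the zeta differences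
to the arguments `n/2`, `(n+1)/2`, at the price of the logarithms. -/
lemma mul_lam_even {n : ℕ} (hn : 1 ≤ n) : (((2 * n : ℕ) * lam (2 * n) : ℝ) : ℂ) =
    (2 : ℂ) ^ (4 * n + 1) / ((2 * n - 1).factorial : ℂ) *
      ∑ k ∈ Finset.Icc 1 n, 1 / (4 : ℂ) ^ k *
        ((n : ℂ) ^ 2 * stirlingP (2 * k - 2) (2 * n - 1) (n : ℂ)
          + stirlingP (2 * k) (2 * n + 1) ((n : ℂ) + 1)) *
        zetaDerivDiff (-2 * (n : ℂ) + 2 * (k : ℂ)) ((n : ℝ) / 2) (((n : ℝ) + 1) / 2)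
    + (2 : ℂ) ^ (4 * n + 1) * (n : ℂ) ^ (2 * n) * (Real.log ((n : ℝ) / 2) : ℂ)
        / ((4 : ℂ) ^ n * ((2 * n - 1).factorial : ℂ)) *
      ∑ k ∈ Finset.Icc 1 n, 1 / (n : ℂ) ^ (2 * k) *
        stirlingP (2 * k) (2 * n + 1) ((n : ℂ) + 1)
    - (2 : ℂ) ^ (4 * n + 1) / ((2 * n - 1).factorial : ℂ) *
      zetaDerivDiff (-2 * (n : ℂ)) (((n : ℝ) + 1) / 2) (((n : ℝ) + 2) / 2) := by
  obtain ⟨p, rfl⟩ := Nat.exists_eq_add_of_le' hn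
  have hI : ∀ f : ℕ → ℂ, ∑ k ∈ Finset.Icc 1 (p + 1), f k =
      ∑ k ∈ Finset.range (p + 1), f (k + 1) := fun f => by
    rw [← Finset.Ico_add_one_right_eq_Icc, Finset.sum_Ico_eq_sum_range]
    exact Finset.sum_congr rfl fun k _ => by rw [add_comm]
  set N : ℕ := p + 1 with hN
  have hpN : (p : ℂ) = N - 1 := by rw [hN]; push_cast; ring
  have hpR : (p : ℝ) = N - 1 := by rw [hN]; push_cast; ring
  have hN0 : (N : ℂ) ≠ 0 := Nat.cast_ne_zero.2 (by omega)
  have hNpos : (0 : ℝ) < N := Nat.cast_pos.2 (by omega)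
  have hfac : ((2 * p + 1).factorial : ℂ) ≠ 0 := Nat.cast_ne_zero.2 (Nat.factorial_ne_zero _)
  have eA : 2 * N - 1 = 2 * p + 1 := by omega
  have eB : 2 * N + 1 = 2 * p + 3 := by omega
  have hX := mul_lam_succ (2 * p + 1)
  have hS := mul_sechZetaDeriv_add_two (2 * p + 1)
  rw [show 2 * p + 1 + 3 = 2 * (p + 1) + 1 + 1 by ring, Finset.sum_range_succ,
    sum_range_two_mul_add_one _ (fun k hk hkn => ?odd)] at hS
  case odd =>
    have := stirlingP_eq_zero_of_odd (m := 2 * p + 3) hk (by omega)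
    push_cast at this ⊢
    rw [show (2 * (p : ℂ) + 3 + 1) / 2 = (2 * p + 1 + 3) / 2 by ring] at this
    rw [this]
    ring
  have hlast : stirlingP (2 * (p + 1) + 1) (2 * p + 1 + 2) ((((2 * p + 1 : ℕ) : ℂ) + 3) / 2) = 0 := by
    have := stirlingP_eq_zero_of_odd (m := 2 * p + 3) (odd_two_mul_add_one (p + 1)) (by omega)
    push_cast at this ⊢
    rw [show (2 * (p : ℂ) + 3 + 1) / 2 = (2 * p + 1 + 3) / 2 by ring] at this
    exact this
  rw [hlast, mul_zero, zero_mul, add_zero, Finset.sum_range_succ'] at hS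
  have hT : sechZetaDeriv (2 * p + 1) = (2 : ℂ) ^ (4 * p + 1) / ((2 * p + 1).factorial : ℂ) *
      ∑ k ∈ Finset.range (p + 1), 1 / (4 : ℂ) ^ k * stirlingP (2 * k) (2 * p + 1) (N : ℂ) *
        zetaDerivDiff (-2 * (N : ℂ) + 2 * ((k + 1 : ℕ) : ℂ)) ((N : ℝ) / 2) (((N : ℝ) + 1) / 2) := by
    have e : (2 : ℂ) ^ (2 * ((2 * p + 1 : ℕ) : ℤ) - 1) = 2 ^ (4 * p + 1) := by
      rw [← zpow_natCast]; congr 1; push_cast; ring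
    rw [sechZetaDeriv, e, Finset.sum_range_succ, sum_range_two_mul_add_one,
      stirlingP_eq_zero_of_odd (odd_two_mul_add_one p) le_rfl, mul_zero, zero_mul, add_zero]
    · congr 1
      refine Finset.sum_congr rfl fun k _ => ?_
      rw [neg_half_pow_two_mul]
      push_cast
      rw [hpN, hpR]
      ring_nf
    · intro k hk hkn
      rw [stirlingP_eq_zero_of_odd hk (by omega)]
      ring
  have hD : ∀ k ∈ Finset.range (p + 1), zetaDerivDiff (-2 * (N : ℂ) + 2 * ((k + 1 : ℕ) : ℂ))
      (((N : ℝ) + 1) / 2) (((N : ℝ) + 2) / 2) =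
      -zetaDerivDiff (-2 * (N : ℂ) + 2 * ((k + 1 : ℕ) : ℂ)) ((N : ℝ) / 2) (((N : ℝ) + 1) / 2) -
        (Real.log ((N : ℝ) / 2) : ℂ) *
          ((N : ℂ) ^ (2 * N) / 4 ^ N * (4 ^ (k + 1) / (N : ℂ) ^ (2 * (k + 1)))) := by
    intro k hk
    have hk : k + 1 ≤ N := by have := Finset.mem_range.1 hk; omega
    have h := zetaDerivDiff_add_one (x := ((N : ℝ) + 1) / 2) (y := (N : ℝ) / 2) (by positivity)
      (by positivity) (-2 * (N : ℂ) + 2 * ((k + 1 : ℕ) : ℂ))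
    rw [show (N : ℝ) / 2 + 1 = (N + 2) / 2 by ring] at h
    rw [h]
    congr 2
    have e : -(-2 * (N : ℂ) + 2 * ((k + 1 : ℕ) : ℂ)) = ((2 * (N - (k + 1)) : ℕ) : ℂ) := by
      rw [Nat.cast_mul, Nat.cast_sub hk]; push_cast; ring
    rw [e, Complex.cpow_natCast]
    obtain ⟨d, hd⟩ := Nat.exists_eq_add_of_le hk
    generalize hq : k + 1 = q at *
    have e2 : N - q = d := by omega
    rw [e2]
    have e3 : (N : ℂ) ^ (2 * N) = (N : ℂ) ^ (2 * q) * (N : ℂ) ^ (2 * d) := by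
      rw [← pow_add]; congr 1; omega
    have e4 : (4 : ℂ) ^ N = 4 ^ q * 4 ^ d := by rw [← pow_add, ← hd]
    rw [e3, e4]
    push_cast
    rw [div_pow, pow_mul (2 : ℂ), show (2 : ℂ) ^ 2 = 4 by norm_num]
    field_simp
  have e1 : ∀ k ∈ Finset.range (p + 1),
      (-(1 / 2) : ℂ) ^ (2 * (k + 1)) *
        stirlingP (2 * (k + 1)) (2 * p + 1 + 2) ((((2 * p + 1 : ℕ) : ℂ) + 3) / 2) *
        zetaDerivDiff (((2 * (k + 1) : ℕ) : ℂ) - ((2 * p + 1 : ℕ) : ℂ) - 1)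
          ((((2 * p + 1 : ℕ) : ℝ) + 3) / 4) ((((2 * p + 1 : ℕ) : ℝ) + 5) / 4) =
      -(1 / 4 ^ (k + 1) * stirlingP (2 * (k + 1)) (2 * p + 3) ((N : ℂ) + 1) *
        zetaDerivDiff (-2 * (N : ℂ) + 2 * ((k + 1 : ℕ) : ℂ)) ((N : ℝ) / 2) (((N : ℝ) + 1) / 2)) -
      (Real.log ((N : ℝ) / 2) : ℂ) * (N : ℂ) ^ (2 * N) / 4 ^ N *
        (1 / (N : ℂ) ^ (2 * (k + 1)) * stirlingP (2 * (k + 1)) (2 * p + 3) ((N : ℂ) + 1)) := by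
    intro k hk
    have a1 : (((2 * p + 1 : ℕ) : ℂ) + 3) / 2 = N + 1 := by push_cast; rw [hpN]; ring
    have a2 : ((2 * (k + 1) : ℕ) : ℂ) - ((2 * p + 1 : ℕ) : ℂ) - 1 =
        -2 * (N : ℂ) + 2 * ((k + 1 : ℕ) : ℂ) := by push_cast; rw [hpN]; ring
    have a3 : (((2 * p + 1 : ℕ) : ℝ) + 3) / 4 = (N + 1) / 2 := by push_cast; rw [hpR]; ring
    have a4 : (((2 * p + 1 : ℕ) : ℝ) + 5) / 4 = (N + 2) / 2 := by push_cast; rw [hpR]; ring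
    rw [neg_half_pow_two_mul, a1, a2, a3, a4, hD k hk]
    field_simp
  have e0 : (-(1 / 2) : ℂ) ^ (2 * 0) *
        stirlingP (2 * 0) (2 * p + 1 + 2) ((((2 * p + 1 : ℕ) : ℂ) + 3) / 2) *
        zetaDerivDiff (((2 * 0 : ℕ) : ℂ) - ((2 * p + 1 : ℕ) : ℂ) - 1)
          ((((2 * p + 1 : ℕ) : ℝ) + 3) / 4) ((((2 * p + 1 : ℕ) : ℝ) + 5) / 4) =
      zetaDerivDiff (-2 * (N : ℂ)) (((N : ℝ) + 1) / 2) (((N : ℝ) + 2) / 2) := by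
    have a2 : ((2 * 0 : ℕ) : ℂ) - ((2 * p + 1 : ℕ) : ℂ) - 1 = -2 * (N : ℂ) := by
      push_cast; rw [hpN]; ring
    have a3 : (((2 * p + 1 : ℕ) : ℝ) + 3) / 4 = (N + 1) / 2 := by push_cast; rw [hpR]; ring
    have a4 : (((2 * p + 1 : ℕ) : ℝ) + 5) / 4 = (N + 2) / 2 := by push_cast; rw [hpR]; ring
    rw [a2, a3, a4, mul_zero, stirlingP_zero, pow_zero, one_mul, one_mul]
  rw [Finset.sum_congr rfl e1, e0, Finset.sum_sub_distrib, Finset.sum_neg_distrib,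
    ← Finset.mul_sum] at hS
  have hsplit : ∑ k ∈ Finset.range (p + 1), 1 / (4 : ℂ) ^ (k + 1) *
        ((N : ℂ) ^ 2 * stirlingP (2 * (k + 1) - 2) (2 * p + 1) (N : ℂ)
          + stirlingP (2 * (k + 1)) (2 * p + 3) ((N : ℂ) + 1)) *
        zetaDerivDiff (-2 * (N : ℂ) + 2 * ((k + 1 : ℕ) : ℂ)) ((N : ℝ) / 2) (((N : ℝ) + 1) / 2) =
      (N : ℂ) ^ 2 / 4 * ∑ k ∈ Finset.range (p + 1), 1 / (4 : ℂ) ^ k *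
        stirlingP (2 * k) (2 * p + 1) (N : ℂ) *
        zetaDerivDiff (-2 * (N : ℂ) + 2 * ((k + 1 : ℕ) : ℂ)) ((N : ℝ) / 2) (((N : ℝ) + 1) / 2) +
      ∑ k ∈ Finset.range (p + 1),
        1 / 4 ^ (k + 1) * stirlingP (2 * (k + 1)) (2 * p + 3) ((N : ℂ) + 1) *
        zetaDerivDiff (-2 * (N : ℂ) + 2 * ((k + 1 : ℕ) : ℂ)) ((N : ℝ) / 2)
          (((N : ℝ) + 1) / 2) := by
    rw [Finset.mul_sum, ← Finset.sum_add_distrib]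
    refine Finset.sum_congr rfl fun k _ => ?_
    rw [show 2 * (k + 1) - 2 = 2 * k by omega, pow_succ]
    field_simp
  have hpow : (2 : ℂ) ^ (4 * N + 1) = 16 * 2 ^ (4 * p + 1) := by
    rw [show 4 * N + 1 = 4 * p + 1 + 4 by omega, pow_add]; norm_num; ring
  have hpow2 : (2 : ℂ) ^ (2 * (2 * p + 1) + 3) = 16 * 2 ^ (4 * p + 1) := by
    rw [show 2 * (2 * p + 1) + 3 = 4 * p + 1 + 4 by omega, pow_add]; norm_num; ring
  rw [hI, hI, eA, eB, hsplit, hpow]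
  have hL : (((2 * N : ℕ) * lam (2 * N) : ℝ) : ℂ) =
      ((((2 * p + 1 : ℕ) : ℝ) + 1) * lam (2 * p + 1 + 1) : ℝ) := by
    rw [show 2 * N = 2 * p + 1 + 1 by omega, Nat.cast_succ]
  have hc : ((2 * p + 1 : ℕ) : ℂ) + 1 = 2 * N := by push_cast; rw [hpN]; ring
  rw [hL, hX, hS, hT, hpow2, hc]
  field_simp
  ring

end SechIntegrals

theorem theorem4p3 :
    -- all the integrals converge
    (∀ n : ℕ, 1 ≤ n →
      MeasureTheory.IntegrableOn (SechIntegrals.chiIntegrand n) (Set.Ioi 0) ∧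
      MeasureTheory.IntegrableOn (SechIntegrals.lamIntegrand n) (Set.Ioi 0) ∧
      MeasureTheory.IntegrableOn (SechIntegrals.delIntegrand n) (Set.Ioi 0)) ∧
    -- the values of chi at even indices
    (∀ n : ℕ, 1 ≤ n →
      (SechIntegrals.chi (2 * n) : ℂ) =
        -(4 * (SechIntegrals.catalanG : ℂ) / (Real.pi : ℂ))
        + (2 : ℂ) ^ (4 * n + 1) / ((2 * n - 1).factorial : ℂ) *
          ∑ k ∈ Finset.Icc 1 n, 1 / (4 : ℂ) ^ k *
            ((n : ℂ) ^ 2 * SechIntegrals.stirlingP (2 * k - 2) (2 * n - 1) (n : ℂ)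
              + SechIntegrals.stirlingP (2 * k) (2 * n + 1) ((n : ℂ) + 1)) *
            SechIntegrals.zetaDerivDiff (-2 * (n : ℂ) + 2 * (k : ℂ))
              ((n : ℝ) / 2) (((n : ℝ) + 1) / 2)
        + (2 : ℂ) ^ (4 * n + 1) * (n : ℂ) ^ (2 * n) * (Real.log ((n : ℝ) / 2) : ℂ)
            / ((4 : ℂ) ^ n * ((2 * n - 1).factorial : ℂ)) *
          ∑ k ∈ Finset.Icc 1 n, 1 / (n : ℂ) ^ (2 * k) *
            SechIntegrals.stirlingP (2 * k) (2 * n + 1) ((n : ℂ) + 1)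
        - (2 : ℂ) ^ (4 * n + 1) / ((2 * n - 1).factorial : ℂ) *
          SechIntegrals.zetaDerivDiff (-2 * (n : ℂ)) (((n : ℝ) + 1) / 2) (((n : ℝ) + 2) / 2)) ∧
    -- the values of chi at odd indices
    (∀ n : ℕ,
      (SechIntegrals.chi (2 * n + 1) : ℂ) =
        -(4 * (SechIntegrals.catalanG : ℂ) / (Real.pi : ℂ))
        + (2 : ℂ) ^ (4 * (n : ℤ) - 1) * (2 * (n : ℂ) + 1) ^ 2 / ((2 * n).factorial : ℂ) *
          ∑ k ∈ Finset.range (n + 1), 1 / (4 : ℂ) ^ k *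
            SechIntegrals.stirlingP (2 * k) (2 * n) ((2 * (n : ℂ) + 1) / 2) *
            SechIntegrals.zetaDerivDiff (-2 * (n : ℂ) + 2 * (k : ℂ) + 1)
              ((2 * (n : ℝ) + 1) / 4) ((2 * (n : ℝ) + 3) / 4)
        - (2 : ℂ) ^ (4 * n + 3) / ((2 * n).factorial : ℂ) *
          ∑ k ∈ Finset.range (n + 2), 1 / (4 : ℂ) ^ k *
            SechIntegrals.stirlingP (2 * k) (2 * n + 2) ((2 * (n : ℂ) + 3) / 2) *
            SechIntegrals.zetaDerivDiff (-2 * (n : ℂ) + 2 * (k : ℂ) - 1)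
              ((2 * (n : ℝ) + 3) / 4) ((2 * (n : ℝ) + 5) / 4)) ∧
    -- the values of lambda at even indices
    (∀ n : ℕ, 1 ≤ n →
      (SechIntegrals.lam (2 * n) : ℂ) =
        (2 : ℂ) ^ (4 * n) / ((n : ℂ) * ((2 * n - 1).factorial : ℂ)) *
          ∑ k ∈ Finset.Icc 1 n, 1 / (4 : ℂ) ^ k *
            ((n : ℂ) ^ 2 * SechIntegrals.stirlingP (2 * k - 2) (2 * n - 1) (n : ℂ)
              + SechIntegrals.stirlingP (2 * k) (2 * n + 1) ((n : ℂ) + 1)) *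
            SechIntegrals.zetaDerivDiff (-2 * (n : ℂ) + 2 * (k : ℂ))
              ((n : ℝ) / 2) (((n : ℝ) + 1) / 2)
        + (2 : ℂ) ^ (2 * n) * (n : ℂ) ^ (2 * n - 1) * (Real.log ((n : ℝ) / 2) : ℂ)
            / ((2 * n - 1).factorial : ℂ) *
          ∑ k ∈ Finset.Icc 1 n, 1 / (n : ℂ) ^ (2 * k) *
            SechIntegrals.stirlingP (2 * k) (2 * n + 1) ((n : ℂ) + 1)
        - (2 : ℂ) ^ (4 * n) / ((n : ℂ) * ((2 * n - 1).factorial : ℂ)) *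
          SechIntegrals.zetaDerivDiff (-2 * (n : ℂ)) (((n : ℝ) + 1) / 2) (((n : ℝ) + 2) / 2)) ∧
    -- the values of lambda at odd indices
    (∀ n : ℕ,
      (SechIntegrals.lam (2 * n + 1) : ℂ) =
        (2 : ℂ) ^ (4 * (n : ℤ) - 1) * (2 * (n : ℂ) + 1) / ((2 * n).factorial : ℂ) *
          ∑ k ∈ Finset.range (n + 1), 1 / (4 : ℂ) ^ k *
            SechIntegrals.stirlingP (2 * k) (2 * n) ((2 * (n : ℂ) + 1) / 2) *
            SechIntegrals.zetaDerivDiff (-2 * (n : ℂ) + 2 * (k : ℂ) + 1)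
              ((2 * (n : ℝ) + 1) / 4) ((2 * (n : ℝ) + 3) / 4)
        - (2 : ℂ) ^ (4 * n + 3) / ((2 * n + 1).factorial : ℂ) *
          ∑ k ∈ Finset.range (n + 2), 1 / (4 : ℂ) ^ k *
            SechIntegrals.stirlingP (2 * k) (2 * n + 2) ((2 * (n : ℂ) + 3) / 2) *
            SechIntegrals.zetaDerivDiff (-2 * (n : ℂ) + 2 * (k : ℂ) - 1)
              ((2 * (n : ℝ) + 3) / 4) ((2 * (n : ℝ) + 5) / 4)) ∧
    -- the values of delta
    (∀ n : ℕ, 1 ≤ n →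
      (SechIntegrals.del n : ℂ) =
        (2 : ℂ) ^ (2 * n - 1) * ((n : ℂ) + 1) ^ 2 / (n.factorial : ℂ) *
          ∑ k ∈ Finset.range (n + 1), (-(1 / 2) : ℂ) ^ k *
            SechIntegrals.stirlingP k n (((n : ℂ) + 1) / 2) *
            SechIntegrals.zetaDerivDiff ((k : ℂ) - (n : ℂ) + 1)
              (((n : ℝ) + 1) / 4) (((n : ℝ) + 3) / 4)
        - (2 : ℂ) ^ (2 * n + 3) / (n.factorial : ℂ) *
          ∑ k ∈ Finset.range (n + 3), (-(1 / 2) : ℂ) ^ k *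
            SechIntegrals.stirlingP k (n + 2) (((n : ℂ) + 3) / 2) *
            SechIntegrals.zetaDerivDiff ((k : ℂ) - (n : ℂ) - 1)
              (((n : ℝ) + 3) / 4) (((n : ℝ) + 5) / 4)
        - (2 : ℂ) ^ (2 * (n : ℤ) - 3) * (n : ℂ) ^ 2 / ((n - 1).factorial : ℂ) *
          ∑ k ∈ Finset.range n, (-(1 / 2) : ℂ) ^ k *
            SechIntegrals.stirlingP k (n - 1) ((n : ℂ) / 2) *
            SechIntegrals.zetaDerivDiff ((k : ℂ) - (n : ℂ) + 2)
              ((n : ℝ) / 4) (((n : ℝ) + 2) / 4)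
        + (2 : ℂ) ^ (2 * n + 1) / ((n - 1).factorial : ℂ) *
          ∑ k ∈ Finset.range (n + 2), (-(1 / 2) : ℂ) ^ k *
            SechIntegrals.stirlingP k (n + 1) (((n : ℂ) + 2) / 2) *
            SechIntegrals.zetaDerivDiff ((k : ℂ) - (n : ℂ))
              (((n : ℝ) + 2) / 4) (((n : ℝ) + 4) / 4)) := by
  open SechIntegrals in
  refine ⟨fun n hn => ⟨integrableOn_chiIntegrand hn, integrableOn_lamIntegrand hn,
    integrableOn_delIntegrand hn⟩, fun n hn => ?_, fun n => ?_, fun n hn => ?_, fun n => ?_,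
    fun n hn => ?_⟩
  · rw [chi_eq_mul_lam (by omega), mul_lam_even hn]
    ring
  · rw [chi_eq_mul_lam (by omega), mul_lam_odd n]
    ring
  · have hn0 : (n : ℂ) ≠ 0 := Nat.cast_ne_zero.2 (by omega)
    have hf : ((2 * n - 1).factorial : ℂ) ≠ 0 := Nat.cast_ne_zero.2 (Nat.factorial_ne_zero _)
    have h := mul_lam_even hn
    have e1 : (2 : ℂ) ^ (4 * n + 1) = 2 * 2 ^ (4 * n) := pow_succ' _ _
    have e2 : (4 : ℂ) ^ n = 2 ^ (2 * n) := by rw [pow_mul]; norm_num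
    have e3 : (2 : ℂ) ^ (4 * n) = 2 ^ (2 * n) * 2 ^ (2 * n) := by rw [← pow_add]; congr 1; ring
    have e4 : (n : ℂ) ^ (2 * n) = n * n ^ (2 * n - 1) := by
      rw [← pow_succ']; congr 1; omega
    rw [e1, e2, e3, e4] at h
    rw [e3]
    push_cast at h
    refine mul_left_cancel₀ (mul_ne_zero two_ne_zero hn0) (h.trans ?_)
    field_simp
  · have h1 : 2 * (n : ℂ) + 1 ≠ 0 := by exact_mod_cast (by omega : 2 * n + 1 ≠ 0)
    have hf : ((2 * n).factorial : ℂ) ≠ 0 := Nat.cast_ne_zero.2 (Nat.factorial_ne_zero _)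
    have h := mul_lam_odd n
    rw [Nat.factorial_succ]
    push_cast at h ⊢
    refine mul_left_cancel₀ h1 (h.trans ?_)
    field_simp
  · obtain ⟨p, rfl⟩ := Nat.exists_eq_add_of_le' hn
    have e1 := mul_lam_succ (p + 1)
    have e2 := mul_lam_succ p
    have e3 := mul_sechZetaDeriv_add_two (p + 1)
    have e4 := mul_sechZetaDeriv_add_two p
    have t1 : (2 : ℂ) ^ (2 * ((p + 1 : ℕ) : ℤ) - 1) = 2 ^ (2 * (p + 1) - 1) := by
      rw [← zpow_natCast]; congr 1; omega
    have t2 : 2 * ((p : ℤ) + 1) - 3 = 2 * (p : ℤ) - 1 := by ring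
    have c1 : (p : ℂ) + 1 + 2 = p + 3 := by ring
    have c2 : (p : ℝ) + 1 + 2 = p + 3 := by ring
    have c3 : (p : ℝ) + 1 + 4 = p + 5 := by ring
    have c4 : ∀ k : ℕ, (k : ℂ) - p - 1 + 2 = k - p + 1 := fun k => by ring
    have c5 : ∀ k : ℕ, (k : ℂ) - (p + 1) = k - p - 1 := fun k => by ring
    rw [e3, sechZetaDeriv, t1] at e1
    rw [e4, sechZetaDeriv] at e2
    rw [del_eq hn, Complex.ofReal_sub, chi_eq_mul_lam hn, chi_eq_mul_lam (by omega),
      Nat.cast_succ (p + 1), e1, Nat.cast_succ (R := ℝ) p, e2]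
    simp only [Nat.add_sub_cancel, Nat.cast_succ, t2, c1, c2, c3, c4, c5]
    ring
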